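/- Let $0\le k<1$ and $k^2\le b\le 1$ with $b>0$. Put $\omega=\frac12(1+k^2-3b)$, $c=\sqrt{b(1-b)(b-k^2)}\ge 0$, $K(k)=\int_0^{\pi/2}\frac{dy}{\sqrt{1-k^2\sin^2y}}$, $T(k)=2K(k)$, and $R^2(x)=b-k^2\,\mathrm{sn}^2(x,k)$. Let $\phi$ be the profile of the corresponding elliptic solution $\Psi=e^{-i\omega t}\phi(x)$ of $i\Psi_t+\frac12\Psi_{xx}+\Psi|\Psi|^2=0$, that is, $\phi(x)=R(x)e^{i\theta(x)}$ with $R=\sqrt{R^2}>0$ and $\theta(x)=c\int_0^xR(y)^{-2}\,dy$ if $b>k^2$, and $\phi(x)=k\,\mathrm{cn}(x,k)$ if $b=k^2$. Set $\Theta=\theta(T(k))$ if $b>k^2$ and $\Theta=\pi$ if $b=k^2$. For $\zeta\in\mathbb C$ let $$A(x;\zeta)=-i\zeta^2+\tfrac i2|\phi(x)|^2+\tfrac i2\omega,\qquad B(x;\zeta)=\zeta\phi(x)+\tfrac i2\phi'(x),$$ let $\Omega=\Omega(\zeta)$ be a square root of $$\Omega^2(\zeta)=-\zeta^4+\omega\zeta^2+c\zeta-\tfrac1{16}\bigl(4\omega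 b+3b^2+(1-k^2)^2\bigr),$$ and, whenever $B(\cdot;\zeta)$ has no zero on $\mathbb R$, let $$I(\zeta)=-\int_0^{T(k)}\frac{i\zeta B+(A-\Omega)\phi+B_x}{B}\,dx,\qquad M(\zeta)=T(k)\mu(\zeta)=-2iI(\zeta)+\Theta+2\pi n,\quad n\in\mathbb Z,$$ so that $M$ is defined modulo $2\pi$ and $e^{iM(\zeta)}=e^{2I(\zeta)+i\Theta}$. If $B(\cdot;\zeta)$ does have a real zero, $M(\zeta)$ modulo $2\pi$ is defined by continuous extension: $e^{iM(\zeta)}$ is the limit of $e^{2I(\zeta')+i\Theta}$ as $(\zeta',\Omega')\to(\zeta,\Omega)$ along the points with $\Omega'^2=\Omega^2(\zeta')$ for which $B(\cdot;\zeta')$ has no real zero. Finally let $$\zeta_1=\tfrac12\bigl(\sqrt{1-b}+i(\sqrt b-\sqrt{b-k^2})\bigr),\qquad \zeta_2=\tfrac12\bigl(-\sqrt{1-b}+i(\sqrt b+\sqrt{b-k^2})\bigr),$$ $$\zeta_3=\tfrac12\bigl(-\sqrt{1-b}-i(\sqrt b+\sqrt{b-k^2})\bigr),\qquad \zeta_4=\tfrac12\bigl(\sqrt{1-b}-i(\sqrt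 b-\sqrt{b-k^2})\bigr).$$ Then $\Omega^2(\zeta)=-(\zeta-\zeta_1)(\zeta-\zeta_2)(\zeta-\zeta_3)(\zeta-\zeta_4)$ for all $\zeta\in\mathbb C$, so that $\zeta_1,\dots,\zeta_4$ are the roots of $\Omega$, and for each $j=1,2,3,4$ the value $M(\zeta_j)$ is well defined modulo $2\pi$ and $$M(\zeta_j)=T(k)\mu(\zeta_j)\equiv 0 \pmod{2\pi}.$$ -/

import Mathlib

open Filter Topology

namespace NLSElliptic

noncomputable section

/-- Incomplete elliptic integral of the first kind with modulus `k`. -/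
def ellipticF (k y : ℝ) : ℝ :=
  ∫ s in (0 : ℝ)..y, 1 / Real.sqrt (1 - k ^ 2 * Real.sin s ^ 2)

/-- Complete elliptic integral of the first kind `K(k)`. -/
def ellipticK (k : ℝ) : ℝ := ellipticF k (Real.pi / 2)

/-- Jacobi amplitude: for `0 ≤ k < 1` the map `ellipticF k : ℝ → ℝ` is a bijection and
`jacobiAm k` is its inverse. -/
def jacobiAm (k x : ℝ) : ℝ := Function.invFun (ellipticF k) x

/-- The Jacobi elliptic function `sn(x, k)`. -/
def jacobiSn (k x : ℝ) : ℝ := Real.sin (jacobiAm k x)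

/-- The Jacobi elliptic function `cn(x, k)`. -/
def jacobiCn (k x : ℝ) : ℝ := Real.cos (jacobiAm k x)

/-- The period `T(k) = 2 K(k)` of the squared amplitude. -/
def period (k : ℝ) : ℝ := 2 * ellipticK k

/-- The frequency `ω = (1 + k² - 3b) / 2`. -/
def omega (k b : ℝ) : ℝ := (1 + k ^ 2 - 3 * b) / 2

/-- The constant `c ≥ 0` with `c² = b (1 - b) (b - k²)`. -/
def phaseConst (k b : ℝ) : ℝ := Real.sqrt (b * (1 - b) * (b - k ^ 2))

/-- The squared amplitude `R²(x) = b - k² sn²(x, k)`. -/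
def ampSq (k b x : ℝ) : ℝ := b - k ^ 2 * jacobiSn k x ^ 2

/-- The phase `θ(x) = c ∫₀ˣ R(y)⁻² dy`. -/
def phase (k b x : ℝ) : ℝ := ∫ y in (0 : ℝ)..x, phaseConst k b / ampSq k b y

/-- The phase increment `θ(T(k))`, set equal to `π` on the line `b = k²`. -/
def phasePeriod (k b : ℝ) : ℝ :=
  if b = k ^ 2 then Real.pi else phase k b (period k)

/-- The stationary profile: `φ = R e^{iθ}` for `b > k²` and `φ = k cn` for `b = k²`
(where the amplitude vanishes at isolated points and changes sign there). -/
def profile (k b x : ℝ) : ℂ :=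
  if b = k ^ 2 then ((k * jacobiCn k x : ℝ) : ℂ)
  else (Real.sqrt (ampSq k b x) : ℂ) * Complex.exp (Complex.I * (phase k b x : ℂ))

/-- The entry `A = -iζ² + (i/2)|φ|² + (i/2)ω` of the temporal Lax matrix. -/
def laxA (k b : ℝ) (ζ : ℂ) (x : ℝ) : ℂ :=
  -Complex.I * ζ ^ 2 + Complex.I / 2 * ((‖profile k b x‖ ^ 2 : ℝ) : ℂ)
    + Complex.I / 2 * (omega k b : ℂ)

/-- The entry `B = ζφ + (i/2)φ_x` of the temporal Lax matrix. -/
def laxB (k b : ℝ) (ζ : ℂ) (x : ℝ) : ℂ :=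
  ζ * profile k b x + Complex.I / 2 * deriv (profile k b) x

/-- The polynomial `Ω²(ζ)`. -/
def OmegaSq (k b : ℝ) (ζ : ℂ) : ℂ :=
  -ζ ^ 4 + (omega k b : ℂ) * ζ ^ 2 + (phaseConst k b : ℂ) * ζ
    - ((4 * omega k b * b + 3 * b ^ 2 + (1 - k ^ 2) ^ 2 : ℝ) : ℂ) / 16

/-- The integrand `(iζB + (A - Ω)φ + B_x) / B`, where `Ω` is a chosen square root of `Ω²(ζ)`. -/
def integrand (k b : ℝ) (ζ Ω : ℂ) (x : ℝ) : ℂ :=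
  (Complex.I * ζ * laxB k b ζ x + (laxA k b ζ x - Ω) * profile k b x
    + deriv (laxB k b ζ) x) / laxB k b ζ x

/-- `I(ζ) = -∫₀^{T(k)} (iζB + (A - Ω)φ + B_x) / B dx`. -/
def bigI (k b : ℝ) (ζ Ω : ℂ) : ℂ :=
  -∫ x in (0 : ℝ)..(period k), integrand k b ζ Ω x

/-- The denominator `B(·; ζ)` has no zero on the real line, so that `I(ζ)` is an ordinary
integral of a continuous function. -/
def IsRegular (k b : ℝ) (ζ : ℂ) : Prop := ∀ x : ℝ, laxB k b ζ x ≠ 0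

/-- The points `(ζ, Ω)` with `Ω² = Ω²(ζ)` and `ζ` regular. -/
def regularCurve (k b : ℝ) : Set (ℂ × ℂ) :=
  {p | p.2 ^ 2 = OmegaSq k b p.1 ∧ IsRegular k b p.1}

/-- `m` is one of the values of `M = T(k) μ` at `ζ`, on the branch `Ω` of the square root of
`Ω²(ζ)`. At a regular `ζ` this means `m = -2i I(ζ) + θ(T(k)) + 2πn` for an integer `n`.
At the remaining `ζ` (the integrand has a pole or is `0/0`) the value of
`e^{iM} = e^{2 I(ζ) + iθ(T(k))}` is obtained by continuous extension from the regular points of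
the curve `Ω² = Ω²(ζ)`. -/
def IsBranchValueOfM (k b : ℝ) (ζ Ω m : ℂ) : Prop :=
  (IsRegular k b ζ ∧
    ∃ n : ℤ, m = -2 * Complex.I * bigI k b ζ Ω + (phasePeriod k b : ℂ)
      + 2 * (Real.pi : ℂ) * (n : ℂ)) ∨
  (¬ IsRegular k b ζ ∧ (𝓝[regularCurve k b] (ζ, Ω)).NeBot ∧
    Tendsto
      (fun p : ℂ × ℂ =>
        Complex.exp (2 * bigI k b p.1 p.2 + Complex.I * (phasePeriod k b : ℂ)))
      (𝓝[regularCurve k b] (ζ, Ω)) (𝓝 (Complex.exp (Complex.I * m))))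

/-- `m` is one of the values of the multivalued function `M(ζ) = T(k) μ(ζ)`, for some square root
`Ω` of `Ω²(ζ)`. -/
def IsValueOfM (k b : ℝ) (ζ m : ℂ) : Prop :=
  ∃ Ω : ℂ, Ω ^ 2 = OmegaSq k b ζ ∧ IsBranchValueOfM k b ζ Ω m

/-- The numbers `ζ₁, ζ₂, ζ₃, ζ₄` (indexed from `0`). -/
def zetaRoot (k b : ℝ) : Fin 4 → ℂ :=
  ![((Real.sqrt (1 - b) : ℂ)
        + Complex.I * ((Real.sqrt b : ℂ) - (Real.sqrt (b - k ^ 2) : ℂ))) / 2,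
    (-(Real.sqrt (1 - b) : ℂ)
        + Complex.I * ((Real.sqrt b : ℂ) + (Real.sqrt (b - k ^ 2) : ℂ))) / 2,
    (-(Real.sqrt (1 - b) : ℂ)
        - Complex.I * ((Real.sqrt b : ℂ) + (Real.sqrt (b - k ^ 2) : ℂ))) / 2,
    ((Real.sqrt (1 - b) : ℂ)
        - Complex.I * ((Real.sqrt b : ℂ) - (Real.sqrt (b - k ^ 2) : ℂ))) / 2]

end

end NLSElliptic

/-! The Lax equation `B_x = -2iζB - 2Aφ` turns the integrand of `I` into `B_x/(2B) - Ωφ/B`. Since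
`B` is multiplied by `e^{iΘ}` over one period, the logarithmic derivative contributes exactly
`e^{-iΘ}`, and `e^{iM} = exp(2Ω ∫ φ/B)` at every regular point (`exp_bigI_of_isRegular`). At a
regular root `Ω = 0`, so `e^{iM} = 1`.

A root can be irregular only in degenerate cases. By `A² - Ω² = BC`, a zero of `B` at a root forces
`A = 0`, hence `ζ²` real. For `k > 0` and `b < 1` every root has nonzero real and imaginary parts,
which excludes this. There remain `b = 1` and `k = 0`, where `∫ φ/B` blows up while `Ω → 0`. It is
enough that `4Ω²(∫ φ/B)² → -4π² = (2πi)²`: then the exponent approaches the set `{2πi, -2πi}`,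
whichever square root is taken, and its exponential tends to `1`.

For `k = 0` the quotient `φ/B` is constant and the limit is algebraic. For `b = 1` the profile is
`dn`, and `∫ φ/B` is a multiple of `F(z) = ∫ dx/(z - g)` with `g = -dn'/dn` and `z = -2iζ`. A Landen
substitution `g = (1 - k') sin χ` splits `F` into an elementary integral with an explicit inverse
square root singularity and a bounded remainder (`exists_integral_decomposition`,
`tendsto_quartic_mul_sq_integral`). -/

namespace NLSElliptic

noncomputable section

/-! ### Jacobi elliptic functions: derivatives and periodicity. -/

/-- The Jacobi elliptic function `dn(x, k)`. -/
def jacobiDn (k x : ℝ) : ℝ := Real.sqrt (1 - k ^ 2 * jacobiSn k x ^ 2)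

lemma one_sub_sq_mul_sin_sq_pos {k : ℝ} (hk : k ^ 2 < 1) (s : ℝ) :
    0 < 1 - k ^ 2 * Real.sin s ^ 2 := by
  nlinarith [Real.sin_sq_le_one s, sq_nonneg (Real.sin s), sq_nonneg k]

lemma continuous_ellipticF_integrand {k : ℝ} (hk : k ^ 2 < 1) :
    Continuous fun s : ℝ => 1 / Real.sqrt (1 - k ^ 2 * Real.sin s ^ 2) := by
  refine Continuous.div continuous_const (by fun_prop) fun s => ?_
  exact (Real.sqrt_pos.2 (one_sub_sq_mul_sin_sq_pos hk s)).ne'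

lemma hasDerivAt_ellipticF {k : ℝ} (hk : k ^ 2 < 1) (y : ℝ) :
    HasDerivAt (ellipticF k) (1 / Real.sqrt (1 - k ^ 2 * Real.sin y ^ 2)) y :=
  intervalIntegral.integral_hasDerivAt_right
    ((continuous_ellipticF_integrand hk).intervalIntegrable _ _)
    (continuous_ellipticF_integrand hk).stronglyMeasurable.stronglyMeasurableAtFilter
    (continuous_ellipticF_integrand hk).continuousAt

lemma ellipticF_zero_right (k : ℝ) : ellipticF k 0 = 0 := by simp [ellipticF]

lemma one_le_ellipticF_integrand {k : ℝ} (hk : k ^ 2 < 1) (s : ℝ) :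
    1 ≤ 1 / Real.sqrt (1 - k ^ 2 * Real.sin s ^ 2) := by
  rw [le_div_iff₀ (Real.sqrt_pos.2 (one_sub_sq_mul_sin_sq_pos hk s)), one_mul, Real.sqrt_le_one]
  have : 0 ≤ k ^ 2 * Real.sin s ^ 2 := by positivity
  linarith

/-- The integrand is at least `1`. This linear growth yields both injectivity and surjectivity, so
that `Function.invFun` in `jacobiAm` is a genuine two-sided inverse. -/
lemma sub_le_ellipticF_sub {k : ℝ} (hk : k ^ 2 < 1) {x y : ℝ} (hxy : x ≤ y) :
    y - x ≤ ellipticF k y - ellipticF k x := by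
  have hm : Monotone fun t => ellipticF k t - t := by
    refine monotone_of_deriv_nonneg
      (fun t => ((hasDerivAt_ellipticF hk t).sub (hasDerivAt_id t)).differentiableAt) fun t => ?_
    have h := ((hasDerivAt_ellipticF hk t).sub (hasDerivAt_id t)).deriv
    have h1 := one_le_ellipticF_integrand hk t
    calc (0 : ℝ) ≤ 1 / Real.sqrt (1 - k ^ 2 * Real.sin t ^ 2) - 1 := by linarith
      _ = _ := h.symm
  have := hm hxy
  simp only at this
  linarith

lemma strictMono_ellipticF {k : ℝ} (hk : k ^ 2 < 1) : StrictMono (ellipticF k) := fun x y hxy => by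
  have := sub_le_ellipticF_sub hk hxy.le
  linarith

lemma continuous_ellipticF {k : ℝ} (hk : k ^ 2 < 1) : Continuous (ellipticF k) :=
  continuous_iff_continuousAt.2 fun y => (hasDerivAt_ellipticF hk y).continuousAt

lemma surjective_ellipticF {k : ℝ} (hk : k ^ 2 < 1) : Function.Surjective (ellipticF k) := by
  refine (continuous_ellipticF hk).surjective ?_ ?_
  · refine tendsto_atTop_mono' _ ?_ tendsto_id
    filter_upwards [eventually_ge_atTop 0] with y hy
    simpa [ellipticF_zero_right] using sub_le_ellipticF_sub hk hy
  · refine tendsto_atBot_mono' _ ?_ tendsto_id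
    filter_upwards [eventually_le_atBot 0] with y hy
    simpa [ellipticF_zero_right] using sub_le_ellipticF_sub hk hy

lemma jacobiAm_ellipticF {k : ℝ} (hk : k ^ 2 < 1) (y : ℝ) : jacobiAm k (ellipticF k y) = y :=
  Function.leftInverse_invFun (strictMono_ellipticF hk).injective y

lemma ellipticF_jacobiAm {k : ℝ} (hk : k ^ 2 < 1) (x : ℝ) : ellipticF k (jacobiAm k x) = x :=
  Function.rightInverse_invFun (surjective_ellipticF hk) x

lemma continuous_jacobiAm {k : ℝ} (hk : k ^ 2 < 1) : Continuous (jacobiAm k) := by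
  refine Monotone.continuous_of_surjective (fun x y hxy => ?_)
    fun y => ⟨_, jacobiAm_ellipticF hk y⟩
  rwa [← (strictMono_ellipticF hk).le_iff_le, ellipticF_jacobiAm hk, ellipticF_jacobiAm hk]

lemma hasDerivAt_jacobiAm {k : ℝ} (hk : k ^ 2 < 1) (x : ℝ) :
    HasDerivAt (jacobiAm k) (jacobiDn k x) x := by
  have hpos := Real.sqrt_pos.2 (one_sub_sq_mul_sin_sq_pos hk (jacobiAm k x))
  have := HasDerivAt.of_local_left_inverse (continuous_jacobiAm hk).continuousAt
    (hasDerivAt_ellipticF hk (jacobiAm k x)) (by positivity)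
    (Eventually.of_forall fun y => ellipticF_jacobiAm hk y)
  simpa [jacobiDn, jacobiSn] using this

lemma jacobiDn_pos {k : ℝ} (hk : k ^ 2 < 1) (x : ℝ) : 0 < jacobiDn k x :=
  Real.sqrt_pos.2 (one_sub_sq_mul_sin_sq_pos hk _)

lemma jacobiDn_sq {k : ℝ} (hk : k ^ 2 < 1) (x : ℝ) :
    jacobiDn k x ^ 2 = 1 - k ^ 2 * jacobiSn k x ^ 2 :=
  Real.sq_sqrt (one_sub_sq_mul_sin_sq_pos hk _).le

lemma jacobiSn_sq_add_jacobiCn_sq (k x : ℝ) : jacobiSn k x ^ 2 + jacobiCn k x ^ 2 = 1 :=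
  Real.sin_sq_add_cos_sq _

lemma hasDerivAt_jacobiSn {k : ℝ} (hk : k ^ 2 < 1) (x : ℝ) :
    HasDerivAt (jacobiSn k) (jacobiCn k x * jacobiDn k x) x :=
  (hasDerivAt_jacobiAm hk x).sin

lemma hasDerivAt_jacobiCn {k : ℝ} (hk : k ^ 2 < 1) (x : ℝ) :
    HasDerivAt (jacobiCn k) (-(jacobiSn k x * jacobiDn k x)) x :=
  (hasDerivAt_jacobiAm hk x).cos.congr_deriv (neg_mul _ _)

lemma hasDerivAt_jacobiDn {k : ℝ} (hk : k ^ 2 < 1) (x : ℝ) :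
    HasDerivAt (jacobiDn k) (-(k ^ 2 * (jacobiSn k x * jacobiCn k x))) x := by
  have h := ((((hasDerivAt_jacobiSn hk x).pow 2).const_mul (k ^ 2)).const_sub 1).sqrt
    (one_sub_sq_mul_sin_sq_pos hk _).ne'
  have hd := jacobiDn_pos hk x
  refine h.congr_deriv ?_
  change _ / (2 * jacobiDn k x) = _
  field_simp
  simp
  ring

lemma continuous_jacobiSn {k : ℝ} (hk : k ^ 2 < 1) : Continuous (jacobiSn k) :=
  Real.continuous_sin.comp (continuous_jacobiAm hk)

lemma continuous_jacobiCn {k : ℝ} (hk : k ^ 2 < 1) : Continuous (jacobiCn k) :=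
  Real.continuous_cos.comp (continuous_jacobiAm hk)

lemma continuous_jacobiDn {k : ℝ} (hk : k ^ 2 < 1) : Continuous (jacobiDn k) :=
  continuous_iff_continuousAt.2 fun x => (hasDerivAt_jacobiDn hk x).continuousAt

/-- The integrand is symmetric about `π/2`, so the two halves of `[0, π]` contribute equally. -/
lemma ellipticF_pi {k : ℝ} (hk : k ^ 2 < 1) : ellipticF k Real.pi = period k := by
  have hi := fun a b => (continuous_ellipticF_integrand hk).intervalIntegrable
    (μ := MeasureTheory.volume) a b
  have h := intervalIntegral.integral_comp_sub_left
    (fun s : ℝ => 1 / Real.sqrt (1 - k ^ 2 * Real.sin s ^ 2)) (a := 0) (b := Real.pi / 2) Real.pi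
  simp only [Real.sin_pi_sub, sub_zero] at h
  rw [period, ellipticK, ellipticF, ← intervalIntegral.integral_add_adjacent_intervals
    (hi 0 (Real.pi / 2)) (hi _ _), ellipticF]
  rw [show Real.pi - Real.pi / 2 = Real.pi / 2 by ring] at h
  rw [← h]
  ring

lemma ellipticF_add_pi {k : ℝ} (hk : k ^ 2 < 1) (y : ℝ) :
    ellipticF k (y + Real.pi) = ellipticF k y + period k := by
  have hi := fun a b => (continuous_ellipticF_integrand hk).intervalIntegrable
    (μ := MeasureTheory.volume) a b
  have hp : Function.Periodic (fun s : ℝ => 1 / Real.sqrt (1 - k ^ 2 * Real.sin s ^ 2))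
      Real.pi := fun s => by simp [Real.sin_add_pi]
  have h := hp.intervalIntegral_add_eq y 0
  rw [zero_add] at h
  rw [← ellipticF_pi hk, ellipticF, ellipticF, ellipticF, ← h,
    intervalIntegral.integral_add_adjacent_intervals (hi _ _) (hi _ _)]

lemma period_pos {k : ℝ} (hk : k ^ 2 < 1) : 0 < period k := by
  rw [← ellipticF_pi hk, ← ellipticF_zero_right k]
  exact strictMono_ellipticF hk Real.pi_pos

lemma jacobiAm_zero {k : ℝ} (hk : k ^ 2 < 1) : jacobiAm k 0 = 0 := by
  simpa [ellipticF_zero_right] using jacobiAm_ellipticF hk 0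

lemma jacobiAm_add_period {k : ℝ} (hk : k ^ 2 < 1) (x : ℝ) :
    jacobiAm k (x + period k) = jacobiAm k x + Real.pi := by
  rw [← jacobiAm_ellipticF hk (jacobiAm k x + Real.pi), ellipticF_add_pi hk,
    ellipticF_jacobiAm hk]

lemma jacobiSn_add_period {k : ℝ} (hk : k ^ 2 < 1) (x : ℝ) :
    jacobiSn k (x + period k) = -jacobiSn k x := by
  simp [jacobiSn, jacobiAm_add_period hk, Real.sin_add_pi]

lemma jacobiCn_add_period {k : ℝ} (hk : k ^ 2 < 1) (x : ℝ) :
    jacobiCn k (x + period k) = -jacobiCn k x := by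
  simp [jacobiCn, jacobiAm_add_period hk, Real.cos_add_pi]

lemma period_zero_modulus : period 0 = Real.pi := by
  simp [period, ellipticK, ellipticF]
  ring

/-! ### The stationary profile, its differential equation and its conserved quantities. -/

open ComplexConjugate

lemma continuous_ampSq {k : ℝ} (hk : k ^ 2 < 1) (b : ℝ) : Continuous (ampSq k b) :=
  continuous_const.sub (continuous_const.mul ((continuous_jacobiSn hk).pow 2))

lemma ampSq_pos {k b : ℝ} (hb : k ^ 2 < b) (x : ℝ) : 0 < ampSq k b x := by
  have := jacobiSn_sq_add_jacobiCn_sq k x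
  unfold ampSq
  nlinarith [sq_nonneg k, sq_nonneg (jacobiCn k x)]

lemma ampSq_add_period {k : ℝ} (hk : k ^ 2 < 1) (b x : ℝ) :
    ampSq k b (x + period k) = ampSq k b x := by
  simp [ampSq, jacobiSn_add_period hk]

lemma phaseConst_sq {k b : ℝ} (hb : k ^ 2 ≤ b) (hb0 : 0 < b) (hb1 : b ≤ 1) :
    phaseConst k b ^ 2 = b * (1 - b) * (b - k ^ 2) :=
  Real.sq_sqrt (mul_nonneg (mul_nonneg hb0.le (by linarith)) (by linarith))

lemma hasDerivAt_ampSq {k : ℝ} (hk : k ^ 2 < 1) (b x : ℝ) :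
    HasDerivAt (ampSq k b) (-(2 * k ^ 2 * (jacobiSn k x * jacobiCn k x * jacobiDn k x))) x := by
  refine ((((hasDerivAt_jacobiSn hk x).pow 2).const_mul (k ^ 2)).const_sub b).congr_deriv ?_
  simp
  ring

lemma continuous_phase_integrand {k b : ℝ} (hk : k ^ 2 < 1) (hb : k ^ 2 < b) :
    Continuous fun y => phaseConst k b / ampSq k b y :=
  continuous_const.div (continuous_ampSq hk b) fun x => (ampSq_pos hb x).ne'

lemma hasDerivAt_phase {k b : ℝ} (hk : k ^ 2 < 1) (hb : k ^ 2 < b) (x : ℝ) :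
    HasDerivAt (phase k b) (phaseConst k b / ampSq k b x) x :=
  intervalIntegral.integral_hasDerivAt_right
    ((continuous_phase_integrand hk hb).intervalIntegrable _ _)
    (continuous_phase_integrand hk hb).stronglyMeasurable.stronglyMeasurableAtFilter
    (continuous_phase_integrand hk hb).continuousAt

lemma phase_add_period {k b : ℝ} (hk : k ^ 2 < 1) (hb : k ^ 2 < b) (x : ℝ) :
    phase k b (x + period k) = phase k b x + phase k b (period k) := by
  have hi := fun u v => (continuous_phase_integrand hk hb).intervalIntegrable
    (μ := MeasureTheory.volume) u v
  have hp : Function.Periodic (fun y => phaseConst k b / ampSq k b y) (period k) :=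
    fun s => by simp [ampSq_add_period hk]
  have h := hp.intervalIntegral_add_eq x 0
  rw [zero_add] at h
  rw [phase, phase, phase, ← h, intervalIntegral.integral_add_adjacent_intervals (hi _ _) (hi _ _)]

lemma profile_of_lt {k b : ℝ} (hb : k ^ 2 < b) (x : ℝ) :
    profile k b x = (Real.sqrt (ampSq k b x) : ℂ) * Complex.exp (Complex.I * (phase k b x : ℂ)) :=
  if_neg hb.ne'

lemma profile_sq_eq (k x : ℝ) : profile k (k ^ 2) x = ((k * jacobiCn k x : ℝ) : ℂ) :=
  if_pos rfl

lemma profile_mul_conj {k b : ℝ} (hb : k ^ 2 ≤ b) (x : ℝ) :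
    profile k b x * conj (profile k b x) = (ampSq k b x : ℂ) := by
  rcases hb.eq_or_lt with rfl | hb
  · rw [profile_sq_eq, Complex.conj_ofReal, ← Complex.ofReal_mul, Complex.ofReal_inj, ampSq]
    linear_combination k ^ 2 * jacobiSn_sq_add_jacobiCn_sq k x
  · rw [Complex.mul_conj, profile_of_lt hb, Complex.normSq_eq_norm_sq, norm_mul,
      mul_comm Complex.I, Complex.norm_exp_ofReal_mul_I, mul_one, Complex.norm_real,
      Real.norm_eq_abs, sq_abs, Real.sq_sqrt (ampSq_pos hb x).le]

lemma norm_profile_sq {k b : ℝ} (hb : k ^ 2 ≤ b) (x : ℝ) :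
    ‖profile k b x‖ ^ 2 = ampSq k b x := by
  have := profile_mul_conj hb x
  rwa [Complex.mul_conj, Complex.normSq_eq_norm_sq, Complex.ofReal_inj] at this

lemma profile_ne_zero {k b : ℝ} (hb : k ^ 2 < b) (x : ℝ) : profile k b x ≠ 0 := fun h => by
  have := norm_profile_sq hb.le x
  simp only [h, norm_zero] at this
  linarith [ampSq_pos hb x]

lemma profile_add_period {k b : ℝ} (hk : k ^ 2 < 1) (hb : k ^ 2 ≤ b) (x : ℝ) :
    profile k b (x + period k) =
      Complex.exp (Complex.I * (phasePeriod k b : ℂ)) * profile k b x := by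
  rcases hb.eq_or_lt with rfl | hb
  · rw [profile_sq_eq, profile_sq_eq, jacobiCn_add_period hk, phasePeriod, if_pos rfl, mul_comm
      Complex.I, Complex.exp_pi_mul_I]
    push_cast
    ring
  · rw [profile_of_lt hb, profile_of_lt hb, ampSq_add_period hk, phase_add_period hk hb,
      phasePeriod, if_neg hb.ne', Complex.ofReal_add, mul_add, Complex.exp_add]
    ring

/-- The logarithmic derivative `φ'/φ = ((R²)'/2 + ic) / R²` of the profile when `b > k²`. -/
def profileLogDeriv (k b x : ℝ) : ℂ :=
  (-((k ^ 2 * (jacobiSn k x * jacobiCn k x * jacobiDn k x) : ℝ) : ℂ)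
    + Complex.I * (phaseConst k b : ℂ)) / (ampSq k b x : ℂ)

lemma hasDerivAt_profile_of_lt {k b : ℝ} (hk : k ^ 2 < 1) (hb : k ^ 2 < b) (x : ℝ) :
    HasDerivAt (profile k b) (profileLogDeriv k b x * profile k b x) x := by
  have hρ := ampSq_pos hb x
  have h1 := ((hasDerivAt_ampSq hk b x).sqrt hρ.ne').ofReal_comp
  have h2 := (((hasDerivAt_phase hk hb x).ofReal_comp).const_mul Complex.I).cexp
  have h3 := h1.mul h2
  have he : profile k b = fun x => (Real.sqrt (ampSq k b x) : ℂ) *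
      Complex.exp (Complex.I * (phase k b x : ℂ)) := funext (profile_of_lt hb)
  rw [he]
  refine h3.congr_deriv ?_
  have hs : (Real.sqrt (ampSq k b x) : ℂ) ^ 2 = (ampSq k b x : ℂ) := by
    exact_mod_cast Real.sq_sqrt hρ.le
  have hs0 : (Real.sqrt (ampSq k b x) : ℂ) ≠ 0 := by exact_mod_cast (Real.sqrt_pos.2 hρ).ne'
  simp only [profileLogDeriv]
  push_cast
  rw [← hs]
  field_simp

/-- Riccati form of `φ'' = -2(ω + |φ|²)φ`. It is a rational identity in `sn`, `cn`, `dn`, so the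
square root and the exponential in `φ` never have to be differentiated twice. -/
lemma hasDerivAt_profileLogDeriv {k b : ℝ} (hk : k ^ 2 < 1) (hb : k ^ 2 < b) (hb0 : 0 < b)
    (hb1 : b ≤ 1) (x : ℝ) :
    HasDerivAt (profileLogDeriv k b)
      (-2 * ((omega k b : ℂ) + (ampSq k b x : ℂ)) - profileLogDeriv k b x ^ 2) x := by
  have hρ := ampSq_pos hb x
  have h1 := ((((hasDerivAt_jacobiSn hk x).mul (hasDerivAt_jacobiCn hk x)).mul
    (hasDerivAt_jacobiDn hk x)).const_mul (k ^ 2)).ofReal_comp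
  have h2 := (h1.neg.add_const (Complex.I * (phaseConst k b : ℂ))).div
    (hasDerivAt_ampSq hk b x).ofReal_comp (by exact_mod_cast hρ.ne')
  refine h2.congr_deriv ?_
  have hρ' : (ampSq k b x : ℂ) ≠ 0 := by exact_mod_cast hρ.ne'
  have hc : (phaseConst k b : ℂ) ^ 2 = b * (1 - b) * (b - k ^ 2) := by
    exact_mod_cast phaseConst_sq hb.le hb0 hb1
  have hs : (jacobiSn k x : ℂ) ^ 2 + (jacobiCn k x : ℂ) ^ 2 = 1 := by
    exact_mod_cast jacobiSn_sq_add_jacobiCn_sq k x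
  have hd : (jacobiDn k x : ℂ) ^ 2 = 1 - k ^ 2 * (jacobiSn k x : ℂ) ^ 2 := by
    exact_mod_cast jacobiDn_sq hk x
  have hr : (ampSq k b x : ℂ) = b - k ^ 2 * (jacobiSn k x : ℂ) ^ 2 := by
    simp [ampSq]
  simp only [profileLogDeriv, omega, Pi.mul_apply, Pi.neg_apply]
  push_cast
  field_simp
  rw [hr]
  have hi := Complex.I_sq
  generalize (jacobiSn k x : ℂ) = s at *
  generalize (jacobiCn k x : ℂ) = q at *
  generalize (jacobiDn k x : ℂ) = d at *
  generalize (phaseConst k b : ℂ) = c at *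
  have hq : q ^ 2 = 1 - s ^ 2 := by linear_combination hs
  linear_combination
    (-k ^ 2 * (b - k ^ 2 * s ^ 2) * (d ^ 2 - k ^ 2 * s ^ 2) - k ^ 4 * d ^ 2 * s ^ 2) * hq
    + (-k ^ 2 * (b - k ^ 2 * s ^ 2) * (1 - 2 * s ^ 2) - k ^ 4 * (1 - s ^ 2) * s ^ 2) * hd
    + c ^ 2 * hi - hc

lemma hasDerivAt_profile_sq {k : ℝ} (hk : k ^ 2 < 1) (x : ℝ) :
    HasDerivAt (profile k (k ^ 2)) (-(k * (jacobiSn k x * jacobiDn k x) : ℝ) : ℂ) x := by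
  have he : profile k (k ^ 2) = fun x => ((k * jacobiCn k x : ℝ) : ℂ) :=
    funext (profile_sq_eq k)
  rw [he]
  refine ((hasDerivAt_jacobiCn hk x).const_mul k).ofReal_comp.congr_deriv ?_
  push_cast
  ring

lemma differentiable_profile {k b : ℝ} (hk : k ^ 2 < 1) (hb : k ^ 2 ≤ b) :
    Differentiable ℝ (profile k b) := fun x => by
  rcases hb.eq_or_lt with rfl | hb
  · exact (hasDerivAt_profile_sq hk x).differentiableAt
  · exact (hasDerivAt_profile_of_lt hk hb x).differentiableAt

lemma deriv_profile_of_lt {k b : ℝ} (hk : k ^ 2 < 1) (hb : k ^ 2 < b) (x : ℝ) :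
    deriv (profile k b) x = profileLogDeriv k b x * profile k b x :=
  (hasDerivAt_profile_of_lt hk hb x).deriv

lemma deriv_profile_sq {k : ℝ} (hk : k ^ 2 < 1) (x : ℝ) :
    deriv (profile k (k ^ 2)) x = (-(k * (jacobiSn k x * jacobiDn k x) : ℝ) : ℂ) :=
  (hasDerivAt_profile_sq hk x).deriv

/-- The profile solves `φ'' = -2 (ω + |φ|²) φ`. -/
lemma hasDerivAt_deriv_profile {k b : ℝ} (hk : k ^ 2 < 1) (hb : k ^ 2 ≤ b) (hb0 : 0 < b)
    (hb1 : b ≤ 1) (x : ℝ) :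
    HasDerivAt (deriv (profile k b))
      (-2 * ((omega k b : ℂ) + (ampSq k b x : ℂ)) * profile k b x) x := by
  rcases hb.eq_or_lt with rfl | hb
  · rw [funext (deriv_profile_sq hk)]
    refine (((hasDerivAt_jacobiSn hk x).mul
      (hasDerivAt_jacobiDn hk x)).const_mul k).ofReal_comp.neg.congr_deriv ?_
    have hd : (jacobiDn k x : ℂ) ^ 2 = 1 - k ^ 2 * (jacobiSn k x : ℂ) ^ 2 := by
      exact_mod_cast jacobiDn_sq hk x
    simp only [profile_sq_eq, omega, ampSq]
    push_cast
    linear_combination -k * (jacobiCn k x : ℂ) * hd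
  · rw [funext (deriv_profile_of_lt hk hb)]
    refine ((hasDerivAt_profileLogDeriv hk hb hb0 hb1 x).mul
      (hasDerivAt_profile_of_lt hk hb x)).congr_deriv ?_
    ring

lemma deriv_profile_add_period {k b : ℝ} (hk : k ^ 2 < 1) (hb : k ^ 2 ≤ b) (x : ℝ) :
    deriv (profile k b) (x + period k) =
      Complex.exp (Complex.I * (phasePeriod k b : ℂ)) * deriv (profile k b) x := by
  rw [← deriv_comp_add_const, funext (profile_add_period hk hb)]
  exact deriv_const_mul _ (differentiable_profile hk hb x)

/-- Wronskian of the profile and its conjugate. -/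
lemma deriv_profile_mul_conj_sub {k b : ℝ} (hk : k ^ 2 < 1) (hb : k ^ 2 ≤ b) (x : ℝ) :
    deriv (profile k b) x * conj (profile k b x) - profile k b x * conj (deriv (profile k b) x)
      = 2 * Complex.I * (phaseConst k b : ℂ) := by
  rcases hb.eq_or_lt with rfl | hb
  · rw [deriv_profile_sq hk, profile_sq_eq]
    simp [phaseConst]
    ring
  · have h0 : (ampSq k b x : ℂ) ≠ 0 := by exact_mod_cast (ampSq_pos hb x).ne'
    rw [deriv_profile_of_lt hk hb, map_mul]
    have h : ∀ w v : ℂ, w * v * conj v - v * (conj w * conj v) = (w - conj w) * (v * conj v) :=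
      fun w v => by ring
    rw [h, profile_mul_conj hb.le]
    simp only [profileLogDeriv, map_div₀, map_add, map_neg, map_mul, Complex.conj_ofReal,
      Complex.conj_I]
    field_simp
    ring

/-- The energy integral of the profile equation. -/
lemma deriv_profile_mul_conj_add {k b : ℝ} (hk : k ^ 2 < 1) (hb : k ^ 2 ≤ b) (hb0 : 0 < b)
    (hb1 : b ≤ 1) (x : ℝ) :
    deriv (profile k b) x * conj (deriv (profile k b) x)
        + ((omega k b : ℂ) + (ampSq k b x : ℂ)) ^ 2
      = (4 * omega k b * b + 3 * b ^ 2 + (1 - k ^ 2) ^ 2 : ℝ) / 4 := by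
  have hs : (jacobiSn k x : ℂ) ^ 2 + (jacobiCn k x : ℂ) ^ 2 = 1 := by
    exact_mod_cast jacobiSn_sq_add_jacobiCn_sq k x
  have hd : (jacobiDn k x : ℂ) ^ 2 = 1 - k ^ 2 * (jacobiSn k x : ℂ) ^ 2 := by
    exact_mod_cast jacobiDn_sq hk x
  rcases hb.eq_or_lt with rfl | hb
  · rw [deriv_profile_sq hk, map_neg, Complex.conj_ofReal]
    simp only [omega, ampSq]
    push_cast
    linear_combination k ^ 2 * (jacobiSn k x : ℂ) ^ 2 * hd
  · have h0 : (ampSq k b x : ℂ) ≠ 0 := by exact_mod_cast (ampSq_pos hb x).ne'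
    have hc : (phaseConst k b : ℂ) ^ 2 = b * (1 - b) * (b - k ^ 2) := by
      exact_mod_cast phaseConst_sq hb.le hb0 hb1
    have hr : (ampSq k b x : ℂ) = b - k ^ 2 * (jacobiSn k x : ℂ) ^ 2 := by
      simp [ampSq]
    rw [deriv_profile_of_lt hk hb, map_mul]
    have h : ∀ w v : ℂ, w * v * (conj w * conj v) = (w * conj w) * (v * conj v) :=
      fun w v => by ring
    rw [h, profile_mul_conj hb.le]
    simp only [profileLogDeriv, map_div₀, map_add, map_neg, map_mul, Complex.conj_ofReal,
      Complex.conj_I, omega]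
    push_cast
    field_simp
    rw [hr]
    have hi := Complex.I_sq
    generalize (jacobiSn k x : ℂ) = s at *
    generalize (jacobiCn k x : ℂ) = q at *
    generalize (jacobiDn k x : ℂ) = d at *
    generalize (phaseConst k b : ℂ) = c at *
    linear_combination 16 * k ^ 4 * s ^ 2 * d ^ 2 * hs + 16 * k ^ 4 * s ^ 2 * (1 - s ^ 2) * hd
      - 16 * c ^ 2 * hi + 16 * hc

/-! ### The temporal Lax matrix. -/

/-- The lower left entry of the temporal Lax matrix, up to sign. -/
def laxC (k b : ℝ) (ζ : ℂ) (x : ℝ) : ℂ :=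
  ζ * conj (profile k b x) - Complex.I / 2 * conj (deriv (profile k b) x)

/-- The coefficients in `ζ` of `A² - BC` are constants of the motion: the Wronskian gives the linear
term and the energy gives the constant term. -/
lemma laxA_sq_sub_OmegaSq {k b : ℝ} (hk : k ^ 2 < 1) (hb : k ^ 2 ≤ b) (hb0 : 0 < b)
    (hb1 : b ≤ 1) (ζ : ℂ) (x : ℝ) :
    laxA k b ζ x ^ 2 - OmegaSq k b ζ = laxB k b ζ x * laxC k b ζ x := by
  have h1 := deriv_profile_mul_conj_add hk hb hb0 hb1 x
  have h2 := deriv_profile_mul_conj_sub hk hb x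
  have h3 := profile_mul_conj hb x
  simp only [laxA, OmegaSq, laxB, laxC, norm_profile_sq hb]
  generalize deriv (profile k b) x = p at *
  generalize profile k b x = f at *
  linear_combination ((-ζ ^ 2 + ampSq k b x / 2 + omega k b / 2) ^ 2 - phaseConst k b * ζ
    + 1 / 4 * p * conj p) * Complex.I_sq - ζ ^ 2 * h3 - ζ * Complex.I / 2 * h2 - 1 / 4 * h1

/-- The off-diagonal entry of the stationary zero-curvature equation; the profile equation
eliminates `φ''`. -/
lemma hasDerivAt_laxB {k b : ℝ} (hk : k ^ 2 < 1) (hb : k ^ 2 ≤ b) (hb0 : 0 < b)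
    (hb1 : b ≤ 1) (ζ : ℂ) (x : ℝ) :
    HasDerivAt (laxB k b ζ)
      (-2 * Complex.I * ζ * laxB k b ζ x - 2 * laxA k b ζ x * profile k b x) x := by
  refine (((differentiable_profile hk hb x).hasDerivAt.const_mul ζ).add
    ((hasDerivAt_deriv_profile hk hb hb0 hb1 x).const_mul (Complex.I / 2))).congr_deriv ?_
  simp only [laxA, laxB, norm_profile_sq hb]
  linear_combination ζ * deriv (profile k b) x * Complex.I_sq

lemma laxB_add_period {k b : ℝ} (hk : k ^ 2 < 1) (hb : k ^ 2 ≤ b) (ζ : ℂ) (x : ℝ) :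
    laxB k b ζ (x + period k) =
      Complex.exp (Complex.I * (phasePeriod k b : ℂ)) * laxB k b ζ x := by
  rw [laxB, profile_add_period hk hb, deriv_profile_add_period hk hb, laxB]
  ring

lemma continuous_profile {k b : ℝ} (hk : k ^ 2 < 1) (hb : k ^ 2 ≤ b) :
    Continuous (profile k b) := (differentiable_profile hk hb).continuous

lemma continuous_laxB {k b : ℝ} (hk : k ^ 2 < 1) (hb : k ^ 2 ≤ b) (hb0 : 0 < b)
    (hb1 : b ≤ 1) (ζ : ℂ) : Continuous (laxB k b ζ) :=
  continuous_iff_continuousAt.2 fun x => (hasDerivAt_laxB hk hb hb0 hb1 ζ x).continuousAt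

lemma continuous_laxA {k b : ℝ} (hk : k ^ 2 < 1) (hb : k ^ 2 ≤ b) (ζ : ℂ) :
    Continuous (laxA k b ζ) := by
  have := continuous_profile hk hb
  unfold laxA
  fun_prop

/-! ### The Floquet exponential at regular points. -/

/-- The function `f · exp(-∫ f'/f)` has zero derivative, so no branch of the complex logarithm is
needed. -/
lemma exp_intervalIntegral_logDeriv {f f' : ℝ → ℂ} (hf : ∀ x, HasDerivAt f (f' x) x)
    (hf' : Continuous f') (h0 : ∀ x, f x ≠ 0) (a b : ℝ) :
    Complex.exp (∫ x in a..b, f' x / f x) = f b / f a := by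
  have hc : Continuous f := continuous_iff_continuousAt.2 fun x => (hf x).continuousAt
  have hq : Continuous fun x => f' x / f x := hf'.div hc h0
  have hF : ∀ x, HasDerivAt (fun y => ∫ t in a..y, f' t / f t) (f' x / f x) x := fun x =>
    intervalIntegral.integral_hasDerivAt_right (hq.intervalIntegrable _ _)
      hq.stronglyMeasurable.stronglyMeasurableAtFilter hq.continuousAt
  have hg : ∀ x, HasDerivAt
      (fun y => f y * Complex.exp (-∫ t in a..y, f' t / f t)) 0 x := fun x => by
    refine ((hf x).mul (hF x).neg.cexp).congr_deriv ?_
    have := h0 x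
    field_simp
    simp
  have h := is_const_of_deriv_eq_zero (fun x => (hg x).differentiableAt)
    (fun x => (hg x).deriv) b a
  simp only [intervalIntegral.integral_same, neg_zero, Complex.exp_zero, mul_one] at h
  rw [← h, Complex.exp_neg]
  have := h0 b
  field_simp

/-- At a regular point the Floquet exponential is `exp (2 Ω ∫ φ / B)`. -/
lemma exp_bigI_of_isRegular {k b : ℝ} (hk : k ^ 2 < 1) (hb : k ^ 2 ≤ b) (hb0 : 0 < b)
    (hb1 : b ≤ 1) {ζ : ℂ} (Ω : ℂ) (hζ : IsRegular k b ζ) :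
    Complex.exp (2 * bigI k b ζ Ω + Complex.I * (phasePeriod k b : ℂ)) =
      Complex.exp (2 * Ω * ∫ x in (0 : ℝ)..(period k), profile k b x / laxB k b ζ x) := by
  set B' : ℝ → ℂ := fun x =>
    -2 * Complex.I * ζ * laxB k b ζ x - 2 * laxA k b ζ x * profile k b x with hB'
  have hd : ∀ x, HasDerivAt (laxB k b ζ) (B' x) x := hasDerivAt_laxB hk hb hb0 hb1 ζ
  have cB := continuous_laxB hk hb hb0 hb1 ζ
  have cA := continuous_laxA hk hb ζ
  have cφ := continuous_profile hk hb
  have cB' : Continuous B' := by fun_prop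
  -- The Lax equation reads `iζB + Aφ = -B'/2`; adding `B'` leaves `B'/2 - Ωφ` in the numerator.
  have hI : ∀ x, integrand k b ζ Ω x =
      1 / 2 * (B' x / laxB k b ζ x) - Ω * (profile k b x / laxB k b ζ x) := fun x => by
    have := hζ x
    rw [integrand, (hd x).deriv]
    field_simp
    simp only [hB']
    ring
  have i1 : IntervalIntegrable (fun x => B' x / laxB k b ζ x) MeasureTheory.volume 0
      (period k) := (cB'.div cB hζ).intervalIntegrable _ _
  have i2 : IntervalIntegrable (fun x => profile k b x / laxB k b ζ x) MeasureTheory.volume 0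
      (period k) := (cφ.div cB hζ).intervalIntegrable _ _
  have hE := exp_intervalIntegral_logDeriv hd cB' hζ 0 (period k)
  have hp := laxB_add_period hk hb ζ 0
  rw [zero_add] at hp
  -- Quasi-periodicity gives `exp(∫ B'/B) = e^{iΘ}`, which cancels the phase factor in `e^{iM}`.
  rw [hp, mul_div_assoc, div_self (hζ 0), mul_one] at hE
  have : 2 * bigI k b ζ Ω = -(∫ x in (0 : ℝ)..(period k), B' x / laxB k b ζ x)
      + 2 * Ω * ∫ x in (0 : ℝ)..(period k), profile k b x / laxB k b ζ x := by
    simp only [bigI, hI]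
    rw [ intervalIntegral.integral_sub (i1.const_mul _) (i2.const_mul _),
      intervalIntegral.integral_const_mul, intervalIntegral.integral_const_mul]
    ring
  rw [this, Complex.exp_add, Complex.exp_add, Complex.exp_neg, hE]
  have := Complex.exp_ne_zero (Complex.I * (phasePeriod k b : ℂ))
  field_simp

/-! ### An elementary trigonometric integral, and exponentials of nearly known squares. -/

/-- Mean value property at the centre of the unit disc: the pole `1/q`, if any, lies outside the
closed disc. -/
lemma integral_one_div_one_sub_mul_exp {q : ℂ} (hq : ‖q‖ < 1) :
    IntervalIntegrable (fun θ : ℝ => 1 / (1 - q * Complex.exp (θ * Complex.I)))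
        MeasureTheory.volume 0 (2 * Real.pi) ∧
      ∫ θ in (0 : ℝ)..(2 * Real.pi), 1 / (1 - q * Complex.exp (θ * Complex.I)) =
        2 * Real.pi := by
  have hne : ∀ z ∈ Metric.closedBall (0 : ℂ) 1, 1 - q * z ≠ 0 := fun z hz h => by
    have h1 : ‖q * z‖ = 1 := by rw [← sub_eq_zero.1 h, norm_one]
    rw [norm_mul] at h1
    have : ‖z‖ ≤ 1 := by simpa using hz
    nlinarith [norm_nonneg q, norm_nonneg z]
  constructor
  · refine Continuous.intervalIntegrable ?_ _ _
    refine Continuous.div continuous_const (by fun_prop) fun θ => hne _ ?_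
    simp [Complex.norm_exp_ofReal_mul_I]
  · have hf : DiffContOnCl ℂ (fun z : ℂ => 1 / (1 - q * z)) (Metric.ball 0 |1|) := by
      refine DifferentiableOn.diffContOnCl fun z hz => ?_
      rw [abs_one, closure_ball _ one_ne_zero] at hz
      refine DifferentiableAt.differentiableWithinAt ?_
      exact (differentiableAt_const _).div (by fun_prop) (hne z hz)
    have h := hf.circleAverage
    simp only [Real.circleAverage, circleMap, mul_zero, sub_zero, zero_add, Complex.ofReal_one,
      one_mul, div_one, Complex.real_smul] at h
    have hpi : (Real.pi : ℂ) ≠ 0 := by exact_mod_cast Real.pi_ne_zero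
    push_cast at h
    field_simp at h
    simpa using h

/-- Cauchy's formula for the constant function `1` at the interior point `q`. -/
lemma integral_exp_div_exp_sub {q : ℂ} (hq : ‖q‖ < 1) :
    IntervalIntegrable (fun θ : ℝ => Complex.exp (θ * Complex.I) /
        (Complex.exp (θ * Complex.I) - q)) MeasureTheory.volume 0 (2 * Real.pi) ∧
      ∫ θ in (0 : ℝ)..(2 * Real.pi), Complex.exp (θ * Complex.I) /
        (Complex.exp (θ * Complex.I) - q) = 2 * Real.pi := by
  constructor
  · refine Continuous.intervalIntegrable ?_ _ _
    refine Continuous.div (by fun_prop) (by fun_prop) fun θ h => ?_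
    have := Complex.norm_exp_ofReal_mul_I θ
    rw [sub_eq_zero.1 h] at this
    linarith
  · have hf : DiffContOnCl ℂ (fun _ : ℂ => (1 : ℂ)) (Metric.ball 0 |1|) := diffContOnCl_const
    have h := hf.circleAverage_smul_div (w := q) (by simpa using hq)
    simp only [Real.circleAverage, circleMap, sub_zero, zero_add, Complex.ofReal_one,
      one_mul, Complex.real_smul, smul_eq_mul, mul_one] at h
    have hpi : (Real.pi : ℂ) ≠ 0 := by exact_mod_cast Real.pi_ne_zero
    push_cast at h
    field_simp at h
    simpa using h

/-- The roots of `q + 1/q = 2w` have product `1`, so one lies inside the unit circle unless both lie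
on it; in that case `w` is a real cosine, hence a real sine. -/
lemma exists_norm_lt_one_joukowsky {w : ℂ} (hw : ∀ ψ : ℝ, w ≠ Real.sin ψ) :
    ∃ q : ℂ, ‖q‖ < 1 ∧ q ^ 2 + 1 = 2 * w * q := by
  obtain ⟨s, hs⟩ := IsAlgClosed.exists_pow_nat_eq (w ^ 2 - 1) (n := 2) (by norm_num)
  have hprod : (w + s) * (w - s) = 1 := by linear_combination -hs
  have hn : ‖w + s‖ * ‖w - s‖ = 1 := by rw [← norm_mul, hprod, norm_one]
  rcases lt_trichotomy ‖w + s‖ 1 with h | h | h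
  · exact ⟨w + s, h, by linear_combination hs⟩
  · exfalso
    obtain ⟨α, hα⟩ : ∃ α : ℝ, Complex.exp (α * Complex.I) = w + s :=
      ⟨Complex.arg (w + s), by
        simpa [h] using Complex.norm_mul_exp_arg_mul_I (w + s)⟩
    refine hw (Real.pi / 2 - α) ?_
    rw [Real.sin_pi_div_two_sub, Complex.ofReal_cos, Complex.cos, neg_mul, Complex.exp_neg, hα]
    have h0 : w + s ≠ 0 := left_ne_zero_of_mul_eq_one hprod
    field_simp
    linear_combination -hs
  · refine ⟨w - s, ?_, by linear_combination hs⟩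
    nlinarith [norm_nonneg (w - s)]

/-- The integral is `2π/√(z² - a²)`; squaring removes the choice of branch. -/
lemma sq_integral_one_div_sub_mul_sin {a : ℝ} (ha : a ≠ 0) {z : ℂ}
    (hz : ∀ ψ : ℝ, z ≠ (a * Real.sin ψ : ℝ)) :
    (∫ ψ in (0 : ℝ)..(2 * Real.pi), 1 / (z - (a * Real.sin ψ : ℝ))) ^ 2 * (z ^ 2 - a ^ 2) =
      4 * Real.pi ^ 2 := by
  have ha' : (a : ℂ) ≠ 0 := by exact_mod_cast ha
  obtain ⟨q, hq1, hq⟩ := exists_norm_lt_one_joukowsky (w := z / a) fun ψ h => hz ψ (by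
    rw [div_eq_iff ha'] at h
    rw [h]
    push_cast
    ring)
  have hz' : 2 * q * z = a * (q ^ 2 + 1) := by
    rw [hq]
    field_simp
  have hq0 : q ≠ 0 := fun h => by simp [h] at hq
  have hq2 : 1 - q ^ 2 ≠ 0 := fun h => by
    have h1 : ‖q ^ 2‖ = 1 := by rw [← sub_eq_zero.1 h, norm_one]
    rw [norm_pow] at h1
    nlinarith [norm_nonneg q]
  obtain ⟨i1, e1⟩ := integral_one_div_one_sub_mul_exp (q := -Complex.I * q) (by simpa using hq1)
  obtain ⟨i2, e2⟩ := integral_exp_div_exp_sub (q := Complex.I * q) (by simpa using hq1)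
  -- Partial fractions in `u = e^{iψ}`: the denominator has the roots `iq` inside and `i/q` outside
  -- the unit circle.
  have hI : ∀ ψ : ℝ, 1 / (z - (a * Real.sin ψ : ℝ)) = (2 * q / (a * (1 - q ^ 2))) *
      (1 / (1 - -Complex.I * q * Complex.exp (ψ * Complex.I)) + Complex.exp (ψ * Complex.I) /
        (Complex.exp (ψ * Complex.I) - Complex.I * q) - 1) := fun ψ => by
    have hi := Complex.I_sq
    have hu := Complex.exp_ne_zero (ψ * Complex.I)
    have hs : ((a * Real.sin ψ : ℝ) : ℂ) = a * (((Complex.exp (ψ * Complex.I))⁻¹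
        - Complex.exp (ψ * Complex.I)) * Complex.I / 2) := by
      rw [Complex.ofReal_mul, Complex.ofReal_sin, Complex.sin, neg_mul, Complex.exp_neg]
    have hne := hz ψ
    rw [hs] at hne ⊢
    generalize Complex.exp (ψ * Complex.I) = u at *
    have hfac : 2 * q * u * (z - a * ((u⁻¹ - u) * Complex.I / 2)) =
        a * ((1 - -Complex.I * q * u) * (u - Complex.I * q)) := by
      field_simp
      linear_combination u * hz' + a * q ^ 2 * u * hi
    have h0 : (1 - -Complex.I * q * u) * (u - Complex.I * q) ≠ 0 := by
      refine right_ne_zero_of_mul (a := (a : ℂ)) ?_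
      rw [← hfac]
      exact mul_ne_zero (mul_ne_zero (mul_ne_zero two_ne_zero hq0) hu) (sub_ne_zero.2 hne)
    have h1 := left_ne_zero_of_mul h0
    have h2 := right_ne_zero_of_mul h0
    have hz3 : z - a * ((u⁻¹ - u) * Complex.I / 2) =
        a * ((1 - -Complex.I * q * u) * (u - Complex.I * q)) / (2 * q * u) := by
      rw [← hfac]
      field_simp
    rw [hz3, one_div_div, div_add_div _ _ h1 h2, div_sub_one h0, div_mul_div_comm,
      div_eq_div_iff (mul_ne_zero ha' h0) (mul_ne_zero (mul_ne_zero ha' hq2) h0)]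
    linear_combination (-2 * q ^ 3 * u * a * ((1 - -Complex.I * q * u) * (u - Complex.I * q))) * hi
  rw [intervalIntegral.integral_congr fun ψ _ => hI ψ, intervalIntegral.integral_const_mul,
    intervalIntegral.integral_sub (i1.add i2) (by simp), intervalIntegral.integral_add i1 i2, e1,
    e2]
  simp only [intervalIntegral.integral_const, sub_zero, Complex.real_smul, mul_one]
  push_cast
  have hzz : z = a * (q ^ 2 + 1) / (2 * q) := by
    rw [← hz']
    field_simp
  rw [hzz]
  field_simp
  ring

/-- In `u² + 4π² = (u - 2πi)(u + 2πi)` a small product forces one factor to be small, and the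
exponential is `1` at both zeros. The sign may vary along the filter. -/
lemma tendsto_exp_of_tendsto_sq {α : Type*} {l : Filter α} {u : α → ℂ}
    (h : Tendsto (fun p => u p ^ 2) l (𝓝 (-(4 * Real.pi ^ 2)))) :
    Tendsto (fun p => Complex.exp (u p)) l (𝓝 1) := by
  rw [Metric.tendsto_nhds]
  intro ε hε
  have hexp := fun w : ℂ => Metric.continuousAt_iff.1 (Complex.continuous_exp.continuousAt (x := w))
    ε hε
  obtain ⟨δ₁, h₁, H₁⟩ := hexp (2 * Real.pi * Complex.I)
  obtain ⟨δ₂, h₂, H₂⟩ := hexp (-(2 * Real.pi * Complex.I))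
  rw [Complex.exp_neg, Complex.exp_two_pi_mul_I, inv_one] at H₂
  rw [Complex.exp_two_pi_mul_I] at H₁
  filter_upwards [Metric.tendsto_nhds.1 h (δ₁ * δ₂) (by positivity)] with p hp
  by_cases hd : dist (u p) (2 * Real.pi * Complex.I) < δ₁
  · exact H₁ hd
  · refine H₂ (lt_of_not_ge fun hd' => ?_)
    have : dist (u p ^ 2) (-(4 * Real.pi ^ 2)) =
        dist (u p) (2 * Real.pi * Complex.I) * dist (u p) (-(2 * Real.pi * Complex.I)) := by
      simp only [dist_eq_norm, ← norm_mul]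
      congr 1
      linear_combination 4 * (Real.pi : ℂ) ^ 2 * Complex.I_sq
    rw [this] at hp
    nlinarith [not_lt.1 hd]

/-! ### The Landen angle. -/

/-- Rotating the vector `(C, S)` by `-χ` gives a constant vector. -/
lemma cos_sin_of_hasDerivAt {C S χ w : ℝ → ℝ} (hC : ∀ x, HasDerivAt C (-(w x * S x)) x)
    (hS : ∀ x, HasDerivAt S (w x * C x) x) (hχ : ∀ x, HasDerivAt χ (w x) x)
    (hC0 : C 0 = 1) (hS0 : S 0 = 0) (hχ0 : χ 0 = 0) (x : ℝ) :
    Real.cos (χ x) = C x ∧ Real.sin (χ x) = S x := by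
  have h1 : ∀ y, HasDerivAt (fun y => C y * Real.cos (χ y) + S y * Real.sin (χ y)) 0 y :=
    fun y => (((hC y).mul (hχ y).cos).add ((hS y).mul (hχ y).sin)).congr_deriv (by ring)
  have h2 : ∀ y, HasDerivAt (fun y => S y * Real.cos (χ y) - C y * Real.sin (χ y)) 0 y :=
    fun y => (((hS y).mul (hχ y).cos).sub ((hC y).mul (hχ y).sin)).congr_deriv (by ring)
  have e1 := is_const_of_deriv_eq_zero (fun y => (h1 y).differentiableAt) (fun y => (h1 y).deriv) x 0
  have e2 := is_const_of_deriv_eq_zero (fun y => (h2 y).differentiableAt) (fun y => (h2 y).deriv) x 0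
  simp only [hC0, hS0, hχ0, Real.cos_zero, Real.sin_zero] at e1 e2
  have h := Real.sin_sq_add_cos_sq (χ x)
  constructor
  · linear_combination C x * h - Real.cos (χ x) * e1 + Real.sin (χ x) * e2
  · linear_combination S x * h - Real.sin (χ x) * e1 - Real.cos (χ x) * e2

/-- The complementary modulus `k' = √(1 - k²)`. -/
def compMod (k : ℝ) : ℝ := Real.sqrt (1 - k ^ 2)

lemma compMod_sq {k : ℝ} (hk : k ^ 2 < 1) : compMod k ^ 2 = 1 - k ^ 2 :=
  Real.sq_sqrt (by linarith)

lemma compMod_pos {k : ℝ} (hk : k ^ 2 < 1) : 0 < compMod k := Real.sqrt_pos.2 (by linarith)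

lemma compMod_lt_one {k : ℝ} (hk : k ^ 2 < 1) (hk0 : k ≠ 0) : compMod k < 1 := by
  have := compMod_sq hk
  have := compMod_pos hk
  have : 0 < k ^ 2 := by positivity
  nlinarith

lemma jacobiDn_le_one (k x : ℝ) : jacobiDn k x ≤ 1 := by
  rw [jacobiDn, Real.sqrt_le_one]
  have : 0 ≤ k ^ 2 * jacobiSn k x ^ 2 := by positivity
  linarith

/-- The second summand of the Landen angle: an antiderivative of `k' / dn`. -/
def complAngle (k x : ℝ) : ℝ := ∫ t in (0 : ℝ)..x, compMod k / jacobiDn k t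

lemma hasDerivAt_complAngle {k : ℝ} (hk : k ^ 2 < 1) (x : ℝ) :
    HasDerivAt (complAngle k) (compMod k / jacobiDn k x) x := by
  have hc : Continuous fun t => compMod k / jacobiDn k t :=
    continuous_const.div (continuous_jacobiDn hk) fun t => (jacobiDn_pos hk t).ne'
  exact intervalIntegral.integral_hasDerivAt_right (hc.intervalIntegrable _ _)
    hc.stronglyMeasurable.stronglyMeasurableAtFilter hc.continuousAt

lemma cos_sin_complAngle {k : ℝ} (hk : k ^ 2 < 1) (x : ℝ) :
    Real.cos (complAngle k x) = jacobiCn k x / jacobiDn k x ∧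
      Real.sin (complAngle k x) = compMod k * jacobiSn k x / jacobiDn k x := by
  have h0 : jacobiSn k 0 = 0 := by simp [jacobiSn, jacobiAm_zero hk]
  refine cos_sin_of_hasDerivAt (C := fun x => jacobiCn k x / jacobiDn k x)
    (S := fun x => compMod k * jacobiSn k x / jacobiDn k x)
    (w := fun x => compMod k / jacobiDn k x) (fun x => ?_) (fun x => ?_)
    (hasDerivAt_complAngle hk) ?_ ?_ ?_ x
  · have hd := (jacobiDn_pos hk x).ne'
    refine ((hasDerivAt_jacobiCn hk x).div (hasDerivAt_jacobiDn hk x) hd).congr_deriv ?_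
    field_simp
    linear_combination -jacobiSn k x * jacobiDn_sq hk x
      + k ^ 2 * jacobiSn k x * jacobiSn_sq_add_jacobiCn_sq k x
      + jacobiSn k x * compMod_sq hk
  · have hd := (jacobiDn_pos hk x).ne'
    refine (((hasDerivAt_jacobiSn hk x).const_mul (compMod k)).div
      (hasDerivAt_jacobiDn hk x) hd).congr_deriv ?_
    field_simp
    linear_combination compMod k * jacobiCn k x * jacobiDn_sq hk x
  · simp [jacobiCn, jacobiDn, jacobiAm_zero hk, h0]
  · simp [h0]
  · simp [complAngle]

/-- The angle increases from `0`, its sine vanishes at the period and, being a positive multiple of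
`sn/dn`, nowhere strictly before it. Hence the angle stops at the first positive multiple of `π`. -/
lemma complAngle_period {k : ℝ} (hk : k ^ 2 < 1) : complAngle k (period k) = Real.pi := by
  have hT := period_pos hk
  have hcont : Continuous (complAngle k) :=
    continuous_iff_continuousAt.2 fun x => (hasDerivAt_complAngle hk x).continuousAt
  have hmono : StrictMono (complAngle k) := strictMono_of_deriv_pos fun x => by
    rw [(hasDerivAt_complAngle hk x).deriv]
    exact div_pos (compMod_pos hk) (jacobiDn_pos hk x)
  have h0 : complAngle k 0 = 0 := by simp [complAngle]
  have hpos : 0 < complAngle k (period k) := h0 ▸ hmono hT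
  have ham : jacobiAm k (period k) = Real.pi := by
    simpa [jacobiAm_zero hk] using jacobiAm_add_period hk 0
  have hsin : Real.sin (complAngle k (period k)) = 0 := by
    rw [(cos_sin_complAngle hk _).2]
    simp [jacobiSn, ham]
  rcases lt_trichotomy (complAngle k (period k)) Real.pi with h | h | h
  · exact absurd hsin (Real.sin_pos_of_pos_of_lt_pi hpos h).ne'
  · exact h
  · exfalso
    obtain ⟨x, hx, hxe⟩ := intermediate_value_Ioo hT.le hcont.continuousOn
      (show Real.pi ∈ Set.Ioo (complAngle k 0) (complAngle k (period k)) from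
        ⟨h0.trans_lt Real.pi_pos, h⟩)
    have h1 : Real.sin (complAngle k x) = 0 := by rw [hxe, Real.sin_pi]
    have ham' : StrictMono (jacobiAm k) := strictMono_of_deriv_pos fun x => by
      rw [(hasDerivAt_jacobiAm hk x).deriv]
      exact jacobiDn_pos hk x
    have h2 : 0 < jacobiSn k x := by
      refine Real.sin_pos_of_pos_of_lt_pi ?_ ?_
      · rw [← jacobiAm_zero hk]
        exact ham' hx.1
      · rw [← ham]
        exact ham' hx.2
    rw [(cos_sin_complAngle hk _).2] at h1
    have := div_pos (mul_pos (compMod_pos hk) h2) (jacobiDn_pos hk x)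
    linarith

/-- The Landen angle. -/
def landenAngle (k x : ℝ) : ℝ := jacobiAm k x + complAngle k x

/-- The quotient `k² sn cn / dn`, which is `-dn' / dn`. -/
def negLogDerivDn (k x : ℝ) : ℝ := k ^ 2 * (jacobiSn k x * jacobiCn k x) / jacobiDn k x

lemma hasDerivAt_landenAngle {k : ℝ} (hk : k ^ 2 < 1) (x : ℝ) :
    HasDerivAt (landenAngle k) (jacobiDn k x + compMod k / jacobiDn k x) x :=
  (hasDerivAt_jacobiAm hk x).add (hasDerivAt_complAngle hk x)

/-- By the addition formula `sin χ = (1 + k') sn cn / dn`, and `(1 - k')(1 + k') = k²`. -/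
lemma negLogDerivDn_eq {k : ℝ} (hk : k ^ 2 < 1) (x : ℝ) :
    negLogDerivDn k x = (1 - compMod k) * Real.sin (landenAngle k x) := by
  have hd := (jacobiDn_pos hk x).ne'
  rw [landenAngle, Real.sin_add, (cos_sin_complAngle hk x).1, (cos_sin_complAngle hk x).2,
    negLogDerivDn]
  change _ = (1 - compMod k) * (jacobiSn k x * _ + jacobiCn k x * _)
  field_simp
  linear_combination jacobiSn k x * jacobiCn k x * compMod_sq hk

/-- The derivative of the angle as an algebraic function of `g`; this is what allows `dx` to be
traded for `dχ`. -/
lemma landenAngle_deriv_sq {k : ℝ} (hk : k ^ 2 < 1) (x : ℝ) :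
    (jacobiDn k x + compMod k / jacobiDn k x) ^ 2 =
      (1 + compMod k) ^ 2 - negLogDerivDn k x ^ 2 := by
  have hd := (jacobiDn_pos hk x).ne'
  have h1 := jacobiDn_sq hk x
  have h2 := jacobiSn_sq_add_jacobiCn_sq k x
  have h3 := compMod_sq hk
  rw [negLogDerivDn]
  field_simp
  linear_combination (jacobiDn k x ^ 2 - k ^ 2 * jacobiSn k x ^ 2 - compMod k ^ 2) * h1
    + k ^ 4 * jacobiSn k x ^ 2 * h2 + k ^ 2 * jacobiSn k x ^ 2 * h3

lemma landenAngle_zero {k : ℝ} (hk : k ^ 2 < 1) : landenAngle k 0 = 0 := by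
  simp [landenAngle, jacobiAm_zero hk, complAngle]

lemma landenAngle_period {k : ℝ} (hk : k ^ 2 < 1) : landenAngle k (period k) = 2 * Real.pi := by
  have ham : jacobiAm k (period k) = Real.pi := by
    simpa [jacobiAm_zero hk] using jacobiAm_add_period hk 0
  rw [landenAngle, ham, complAngle_period hk]
  ring

lemma abs_negLogDerivDn_le {k : ℝ} (hk : k ^ 2 < 1) (hk0 : k ≠ 0) (x : ℝ) :
    |negLogDerivDn k x| ≤ 1 - compMod k := by
  have := compMod_lt_one hk hk0
  rw [negLogDerivDn_eq hk, abs_mul, abs_of_pos (by linarith : 0 < 1 - compMod k)]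
  exact mul_le_of_le_one_right (by linarith) (Real.abs_sin_le_one _)

lemma continuous_negLogDerivDn {k : ℝ} (hk : k ^ 2 < 1) : Continuous (negLogDerivDn k) :=
  (continuous_const.mul ((continuous_jacobiSn hk).mul (continuous_jacobiCn hk))).div
    (continuous_jacobiDn hk) fun x => (jacobiDn_pos hk x).ne'

/-! ### Singular behaviour of `∫ dx/(z - g)` at `z = ±(1 - k')`. -/

lemma exists_sq_eq_re_nonneg (w : ℂ) : ∃ e : ℂ, e ^ 2 = w ∧ 0 ≤ e.re := by
  obtain ⟨e, he⟩ := IsAlgClosed.exists_pow_nat_eq w (n := 2) (by norm_num)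
  rcases le_total 0 e.re with h | h
  · exact ⟨e, he, h⟩
  · exact ⟨-e, by rw [neg_sq, he], by simpa using h⟩

/-- Over one period the Landen angle sweeps all of `[0, 2π]`, so `g` takes every value `(1 - k') sin
ψ`. -/
lemma ne_mul_sin_of_ne_negLogDerivDn {k : ℝ} (hk : k ^ 2 < 1) {z : ℂ}
    (hz : ∀ x, z ≠ negLogDerivDn k x) (ψ : ℝ) :
    z ≠ ((1 - compMod k) * Real.sin ψ : ℝ) := fun h => by
  obtain ⟨ψ', hψ', he⟩ := Real.sin_periodic.exists_mem_Ico₀ Real.two_pi_pos ψ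
  have hcont : Continuous (landenAngle k) :=
    continuous_iff_continuousAt.2 fun x => (hasDerivAt_landenAngle hk x).continuousAt
  obtain ⟨x, -, hx⟩ := intermediate_value_Icc (period_pos hk).le hcont.continuousOn
    (show ψ' ∈ Set.Icc (landenAngle k 0) (landenAngle k (period k)) by
      rw [landenAngle_zero hk, landenAngle_period hk]
      exact ⟨hψ'.1, hψ'.2.le⟩)
  exact hz x (by rw [h, negLogDerivDn_eq hk, hx, he])

/-- Decomposition of the elliptic integral of the third kind `∫ dx / (z - g)` near the branch
points `±(1 - k')` into an elementary integral and a bounded remainder. -/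
lemma exists_integral_decomposition {k : ℝ} (hk : k ^ 2 < 1) (hk0 : k ≠ 0) {z : ℂ}
    (hz : ∀ x, z ≠ negLogDerivDn k x) :
    ∃ e J N : ℂ, e ^ 2 = (1 + compMod k : ℝ) ^ 2 - z ^ 2 ∧
      J ^ 2 * (z ^ 2 - (1 - compMod k : ℝ) ^ 2) = 4 * Real.pi ^ 2 ∧
      ‖N‖ ≤ (‖z‖ + 1) / compMod k * period k ∧
      e * (∫ x in (0 : ℝ)..(period k), 1 / (z - negLogDerivDn k x)) = J + N := by
  -- The choice `Re e ≥ 0`, together with `w ≥ k' > 0`, keeps `e + w` away from zero uniformly in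
  -- `z`.
  obtain ⟨e, he, her⟩ := exists_sq_eq_re_nonneg ((1 + compMod k : ℝ) ^ 2 - z ^ 2)
  have hlt := compMod_lt_one hk hk0
  have hpos := compMod_pos hk
  have hJ := sq_integral_one_div_sub_mul_sin (sub_ne_zero.2 hlt.ne')
    (ne_mul_sin_of_ne_negLogDerivDn hk hz)
  have hcg := continuous_negLogDerivDn hk
  have hcd := continuous_jacobiDn hk
  set w : ℝ → ℝ := fun x => jacobiDn k x + compMod k / jacobiDn k x with hw
  have hcw : Continuous w :=
    hcd.add (continuous_const.div hcd fun x => (jacobiDn_pos hk x).ne')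
  have hzs : ∀ x, z - negLogDerivDn k x ≠ 0 := fun x => sub_ne_zero.2 (hz x)
  have hwge : ∀ x, compMod k ≤ w x := fun x => by
    have h1 := jacobiDn_pos hk x
    have h2 : compMod k ≤ compMod k / jacobiDn k x := by
      rw [le_div_iff₀ h1]
      exact mul_le_of_le_one_right hpos.le (jacobiDn_le_one k x)
    simp only [hw]
    linarith
  have hre : ∀ x, compMod k ≤ ‖e + w x‖ := fun x => by
    refine le_trans ?_ (Complex.re_le_norm _)
    simp only [Complex.add_re, Complex.ofReal_re]
    linarith [hwge x]
  -- Write `e = w + (e - w)`. Since `e² - w² = g² - z²`, the factor `z - g` cancels from the second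
  -- term.
  have hsplit : ∀ x, e * (1 / (z - negLogDerivDn k x)) =
      (w x : ℂ) / (z - negLogDerivDn k x) + -((z + negLogDerivDn k x) / (e + w x)) := fun x => by
    have h0 : e + w x ≠ 0 := norm_pos_iff.1 (hpos.trans_le (hre x))
    have h1 := hzs x
    have h2 : (w x : ℂ) ^ 2 = (1 + compMod k : ℝ) ^ 2 - (negLogDerivDn k x : ℂ) ^ 2 := by
      exact_mod_cast landenAngle_deriv_sq hk x
    field_simp
    linear_combination he - h2
  have i1 : IntervalIntegrable (fun x => (w x : ℂ) / (z - negLogDerivDn k x))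
      MeasureTheory.volume 0 (period k) :=
    ((Complex.continuous_ofReal.comp hcw).div (by fun_prop) hzs).intervalIntegrable _ _
  have i2 : IntervalIntegrable (fun x => -((z + negLogDerivDn k x) / (e + w x)))
      MeasureTheory.volume 0 (period k) := by
    refine Continuous.intervalIntegrable (Continuous.neg (Continuous.div ?_ ?_ fun x =>
      norm_pos_iff.1 (hpos.trans_le (hre x)))) _ _
    · fun_prop
    · fun_prop
  refine ⟨e, _, ∫ x in (0 : ℝ)..(period k), -((z + negLogDerivDn k x) / (e + w x)), he, hJ,
    ?_, ?_⟩
  · have hT := (period_pos hk).le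
    have := intervalIntegral.norm_integral_le_of_norm_le_const (a := 0) (b := period k)
      (f := fun x => -((z + negLogDerivDn k x) / (e + w x))) (C := (‖z‖ + 1) / compMod k)
      fun x _ => by
        rw [norm_neg, norm_div]
        refine div_le_div₀ (by positivity) ((norm_add_le _ _).trans ?_) hpos (hre x)
        rw [Complex.norm_real, Real.norm_eq_abs]
        linarith [abs_negLogDerivDn_le hk hk0 x]
    rwa [sub_zero, abs_of_nonneg hT] at this
  · rw [← intervalIntegral.integral_const_mul, intervalIntegral.integral_congr fun x _ => hsplit x,
      intervalIntegral.integral_add i1 i2]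
    congr 1
    -- Here `w` is the derivative of the Landen angle, so `ψ = χ(x)` turns the singular term into
    -- the elementary integral over `[0, 2π]`.
    have hcv := intervalIntegral.integral_deriv_smul_comp
      (f := landenAngle k) (f' := w) (a := 0) (b := period k)
      (g := fun ψ => 1 / (z - ((1 - compMod k) * Real.sin ψ : ℝ)))
      (fun x _ => hasDerivAt_landenAngle hk x) hcw.continuousOn
      (Continuous.div continuous_const (by fun_prop) fun ψ =>
        sub_ne_zero.2 (ne_mul_sin_of_ne_negLogDerivDn hk hz ψ))
    rw [landenAngle_zero hk, landenAngle_period hk] at hcv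
    rw [← hcv]
    refine intervalIntegral.integral_congr fun x _ => ?_
    simp only [Function.comp, Complex.real_smul, ← negLogDerivDn_eq hk]
    ring

lemma tendsto_quartic_mul_sq_integral {k : ℝ} (hk : k ^ 2 < 1) (hk0 : k ≠ 0) {z₀ : ℂ}
    (hz₀ : z₀ ^ 2 = (1 - compMod k : ℝ) ^ 2) {α : Type*} {l : Filter α} {z : α → ℂ}
    (hl : Tendsto z l (𝓝 z₀)) (hz : ∀ᶠ p in l, ∀ x, z p ≠ negLogDerivDn k x) :
    Tendsto (fun p => (z p ^ 2 - (1 - compMod k : ℝ) ^ 2) * (z p ^ 2 - (1 + compMod k : ℝ) ^ 2) *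
      (∫ x in (0 : ℝ)..(period k), 1 / (z p - negLogDerivDn k x)) ^ 2) l
      (𝓝 (-(4 * Real.pi ^ 2))) := by
  rw [tendsto_iff_norm_sub_tendsto_zero]
  set d : α → ℝ := fun p => ‖z p ^ 2 - (1 - compMod k : ℝ) ^ 2‖ with hd
  set m : α → ℝ := fun p => (‖z p‖ + 1) / compMod k * period k with hm
  have hd0 : Tendsto d l (𝓝 0) := by
    have := ((hl.pow 2).sub_const (((1 - compMod k : ℝ) : ℂ) ^ 2)).norm
    rwa [hz₀, sub_self, norm_zero] at this
  have hm0 : Tendsto m l (𝓝 ((‖z₀‖ + 1) / compMod k * period k)) :=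
    ((hl.norm.add_const 1).div_const _).mul_const _
  have hs0 : Tendsto (fun p => Real.sqrt (d p)) l (𝓝 0) := by
    simpa using hd0.sqrt
  have hlim : Tendsto (fun p => 4 * Real.pi * Real.sqrt (d p) * m p + d p * m p ^ 2) l (𝓝 0) := by
    simpa using ((hs0.const_mul (4 * Real.pi)).mul hm0).add (hd0.mul (hm0.pow 2))
  refine squeeze_zero' (Eventually.of_forall fun _ => norm_nonneg _) ?_ hlim
  filter_upwards [hz] with p hp
  obtain ⟨e, J, N, he, hJ, hN, hF⟩ := exists_integral_decomposition hk hk0 hp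
  generalize (∫ x in (0 : ℝ)..(period k), 1 / (z p - negLogDerivDn k x)) = F at *
  -- Substituting `eF = J + N` makes the `J²` term exactly `-4π²`; only the cross term and the `N²`
  -- term remain as error.
  have hkey : (z p ^ 2 - (1 - compMod k : ℝ) ^ 2) * (z p ^ 2 - (1 + compMod k : ℝ) ^ 2) * F ^ 2
      - -(4 * Real.pi ^ 2) = -((z p ^ 2 - (1 - compMod k : ℝ) ^ 2) * (2 * J * N + N ^ 2)) := by
    linear_combination (z p ^ 2 - (1 - compMod k : ℝ) ^ 2) * F ^ 2 * he - hJ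
      - (z p ^ 2 - (1 - compMod k : ℝ) ^ 2) * (e * F + J + N) * hF
  have hJd : ‖J‖ ^ 2 * d p = (2 * Real.pi) ^ 2 := by
    rw [hd, ← norm_pow, ← norm_mul, hJ]
    simp [abs_of_pos Real.pi_pos]
    ring
  have hdp : 0 ≤ d p := norm_nonneg _
  -- `J` grows only like `d^{-1/2}`, so the cross term `d · J · N` is still of order `√d`.
  have hJs : ‖J‖ * Real.sqrt (d p) = 2 * Real.pi := by
    have h1 : (‖J‖ * Real.sqrt (d p)) ^ 2 = (2 * Real.pi) ^ 2 := by
      rw [mul_pow, Real.sq_sqrt hdp, hJd]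
    exact (sq_eq_sq₀ (by positivity) (by positivity)).1 h1
  rw [hkey, norm_neg, norm_mul]
  calc d p * ‖2 * J * N + N ^ 2‖ ≤ d p * (2 * ‖J‖ * ‖N‖ + ‖N‖ ^ 2) := by
        gcongr
        refine (norm_add_le _ _).trans (le_of_eq ?_)
        simp
    _ = 4 * Real.pi * Real.sqrt (d p) * ‖N‖ + d p * ‖N‖ ^ 2 := by
        have h2 : d p = Real.sqrt (d p) * Real.sqrt (d p) := (Real.mul_self_sqrt hdp).symm
        linear_combination 2 * ‖J‖ * ‖N‖ * h2 + 2 * ‖N‖ * Real.sqrt (d p) * hJs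
    _ ≤ _ := by gcongr

/-! ### The roots of `Ω²`, and reduction to a limit at irregular roots. -/

lemma OmegaSq_eq_prod {k b : ℝ} (hb : k ^ 2 ≤ b) (hb0 : 0 < b) (hb1 : b ≤ 1) (ζ : ℂ) :
    OmegaSq k b ζ = -((ζ - zetaRoot k b 0) * (ζ - zetaRoot k b 1) * (ζ - zetaRoot k b 2)
      * (ζ - zetaRoot k b 3)) := by
  have hc : phaseConst k b = Real.sqrt b * Real.sqrt (1 - b) * Real.sqrt (b - k ^ 2) := by
    rw [phaseConst, Real.sqrt_mul (mul_nonneg hb0.le (by linarith)), Real.sqrt_mul hb0.le]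
  have hp : (Real.sqrt (1 - b) : ℂ) ^ 2 = 1 - b := by
    exact_mod_cast Real.sq_sqrt (by linarith : 0 ≤ 1 - b)
  have hq : (Real.sqrt b : ℂ) ^ 2 = b := by exact_mod_cast Real.sq_sqrt hb0.le
  have hr : (Real.sqrt (b - k ^ 2) : ℂ) ^ 2 = b - k ^ 2 := by
    exact_mod_cast Real.sq_sqrt (by linarith : 0 ≤ b - k ^ 2)
  simp only [OmegaSq, hc, omega, zetaRoot, Matrix.cons_val]
  push_cast
  have hi := Complex.I_sq
  generalize (Real.sqrt (1 - b) : ℂ) = p at *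
  generalize (Real.sqrt b : ℂ) = q at *
  generalize (Real.sqrt (b - k ^ 2) : ℂ) = r at *
  have hk : (k : ℂ) ^ 2 = q ^ 2 - r ^ 2 := by linear_combination -hq + hr
  have h4 : (k : ℂ) ^ 4 = (q ^ 2 - r ^ 2) ^ 2 := by rw [← hk]; ring
  -- The roots form two conjugate pairs, so the quartic is a product of two quadratics with real
  -- coefficients.
  have h1 : (ζ - (p + Complex.I * (q - r)) / 2) * (ζ - (p - Complex.I * (q - r)) / 2) =
      (ζ - p / 2) ^ 2 + (q - r) ^ 2 / 4 := by linear_combination -(q - r) ^ 2 / 4 * hi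
  have h2 : (ζ - (-p + Complex.I * (q + r)) / 2) * (ζ - (-p - Complex.I * (q + r)) / 2) =
      (ζ + p / 2) ^ 2 + (q + r) ^ 2 / 4 := by linear_combination -(q + r) ^ 2 / 4 * hi
  rw [mul_right_comm _ _ (ζ - (p - Complex.I * (q - r)) / 2),
    mul_right_comm _ _ (ζ - (p - Complex.I * (q - r)) / 2), h1,
    mul_assoc ((ζ - p / 2) ^ 2 + (q - r) ^ 2 / 4), h2]
  have hp' : p ^ 2 = 1 - q ^ 2 := by rw [hp, hq]
  have hp4 : p ^ 4 = (1 - q ^ 2) ^ 2 := by rw [← hp']; ring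
  rw [← hq]
  ring_nf
  rw [h4, hk, hp4, hp']
  ring

lemma OmegaSq_zetaRoot {k b : ℝ} (hb : k ^ 2 ≤ b) (hb0 : 0 < b) (hb1 : b ≤ 1) (j : Fin 4) :
    OmegaSq k b (zetaRoot k b j) = 0 := by
  rw [OmegaSq_eq_prod hb hb0 hb1]
  fin_cases j <;> simp

/-- A point at which `B` vanishes somewhere and `Ω² = 0` has a real square. -/
lemma sq_eq_of_laxB_eq_zero {k b : ℝ} (hk : k ^ 2 < 1) (hb : k ^ 2 ≤ b) (hb0 : 0 < b)
    (hb1 : b ≤ 1) {ζ : ℂ} (hζ : OmegaSq k b ζ = 0) {x : ℝ} (hx : laxB k b ζ x = 0) :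
    ζ ^ 2 = ((ampSq k b x + omega k b) / 2 : ℝ) := by
  have h := laxA_sq_sub_OmegaSq hk hb hb0 hb1 ζ x
  rw [hζ, hx, zero_mul, sub_zero] at h
  have hA := pow_eq_zero_iff two_ne_zero |>.1 h
  rw [laxA, norm_profile_sq hb] at hA
  push_cast
  linear_combination Complex.I * hA + (ζ ^ 2 - ampSq k b x / 2 - omega k b / 2) * Complex.I_sq

lemma laxB_of_lt {k b : ℝ} (hk : k ^ 2 < 1) (hb : k ^ 2 < b) (ζ : ℂ) (x : ℝ) :
    laxB k b ζ x = (ζ + Complex.I / 2 * profileLogDeriv k b x) * profile k b x := by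
  rw [laxB, deriv_profile_of_lt hk hb]
  ring

lemma profile_div_laxB_of_lt {k b : ℝ} (hk : k ^ 2 < 1) (hb : k ^ 2 < b) (ζ : ℂ) (x : ℝ) :
    profile k b x / laxB k b ζ x = 1 / (ζ + Complex.I / 2 * profileLogDeriv k b x) := by
  have := profile_ne_zero hb x
  rw [laxB_of_lt hk hb, div_mul_cancel_right₀ this, one_div]

lemma isRegular_iff_of_lt {k b : ℝ} (hk : k ^ 2 < 1) (hb : k ^ 2 < b) (ζ : ℂ) :
    IsRegular k b ζ ↔ ∀ x, ζ + Complex.I / 2 * profileLogDeriv k b x ≠ 0 := by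
  simp only [IsRegular, laxB_of_lt hk hb, mul_ne_zero_iff, profile_ne_zero hb, ne_eq,
    not_false_eq_true, and_true]

/-- A point `ζ` with `Ω(ζ) = 0` whose right translates are regular is a limit of regular points
of the curve. -/
lemma neBot_nhdsWithin_regularCurve {k b : ℝ} {ζ : ℂ} (h0 : OmegaSq k b ζ = 0)
    (hreg : ∀ ε : ℝ, 0 < ε → IsRegular k b (ζ + ε)) :
    (𝓝[regularCurve k b] (ζ, (0 : ℂ))).NeBot := by
  -- No continuity of this choice is needed: `|Ω| = √|Ω²|` already tends to zero.
  choose Ω hΩ using fun ε : ℝ => IsAlgClosed.exists_pow_nat_eq (OmegaSq k b (ζ + ε)) two_pos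
  have hcont : Continuous fun ε : ℝ => OmegaSq k b (ζ + ε) := by
    unfold OmegaSq
    fun_prop
  have hζ : Tendsto (fun ε : ℝ => ζ + (ε : ℂ)) (𝓝[>] 0) (𝓝 ζ) := by
    have : Continuous fun ε : ℝ => ζ + (ε : ℂ) := by fun_prop
    simpa using (this.tendsto 0).mono_left (nhdsWithin_le_nhds (s := Set.Ioi 0))
  have hO : Tendsto Ω (𝓝[>] 0) (𝓝 0) := by
    rw [tendsto_zero_iff_norm_tendsto_zero]
    have h1 : Tendsto (fun ε : ℝ => Real.sqrt ‖OmegaSq k b (ζ + ε)‖) (𝓝[>] 0) (𝓝 0) := by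
      have := (hcont.norm.sqrt.tendsto 0).mono_left (nhdsWithin_le_nhds (s := Set.Ioi 0))
      simpa [h0] using this
    refine h1.congr fun ε => ?_
    rw [← hΩ, norm_pow, Real.sqrt_sq (norm_nonneg _)]
  have : Tendsto (fun ε : ℝ => (ζ + (ε : ℂ), Ω ε)) (𝓝[>] 0)
      (𝓝[regularCurve k b] (ζ, (0 : ℂ))) := by
    refine tendsto_nhdsWithin_iff.2 ⟨hζ.prodMk_nhds hO, ?_⟩
    filter_upwards [self_mem_nhdsWithin] with ε hε
    exact ⟨hΩ ε, hreg ε hε⟩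
  exact this.neBot

/-- Reduction of the limit statement on the curve to the square of the exponent. -/
lemma tendsto_exp_bigI {k b : ℝ} (hk : k ^ 2 < 1) (hb : k ^ 2 ≤ b) (hb0 : 0 < b) (hb1 : b ≤ 1)
    {p₀ : ℂ × ℂ}
    (h : Tendsto (fun p : ℂ × ℂ => 4 * OmegaSq k b p.1 *
        (∫ x in (0 : ℝ)..(period k), profile k b x / laxB k b p.1 x) ^ 2)
      (𝓝[regularCurve k b] p₀) (𝓝 (-(4 * (Real.pi : ℂ) ^ 2)))) :
    Tendsto (fun p : ℂ × ℂ =>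
        Complex.exp (2 * bigI k b p.1 p.2 + Complex.I * (phasePeriod k b : ℂ)))
      (𝓝[regularCurve k b] p₀) (𝓝 1) := by
  have hs : ∀ᶠ p in 𝓝[regularCurve k b] p₀, p ∈ regularCurve k b := self_mem_nhdsWithin
  have h1 : Tendsto (fun p : ℂ × ℂ => (2 * p.2 *
        (∫ x in (0 : ℝ)..(period k), profile k b x / laxB k b p.1 x)) ^ 2)
      (𝓝[regularCurve k b] p₀) (𝓝 (-(4 * (Real.pi : ℂ) ^ 2))) := by
    refine h.congr' ?_
    filter_upwards [hs] with p hp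
    rw [← hp.1]
    ring
  refine (tendsto_exp_of_tendsto_sq h1).congr' ?_
  filter_upwards [hs] with p hp
  rw [exp_bigI_of_isRegular hk hb hb0 hb1 p.2 hp.2]

/-- At a root the only square root is `Ω = 0`, so there is a single branch. The `NeBot` part makes
the limit unique, which gives the forward direction at an irregular root. -/
lemma isValueOfM_iff_of_limit {k b : ℝ} (hk : k ^ 2 < 1) (hb : k ^ 2 ≤ b) (hb0 : 0 < b)
    (hb1 : b ≤ 1) {ζ : ℂ} (h0 : OmegaSq k b ζ = 0)
    (hlim : ¬IsRegular k b ζ → (𝓝[regularCurve k b] (ζ, (0 : ℂ))).NeBot ∧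
      Tendsto (fun p : ℂ × ℂ =>
        Complex.exp (2 * bigI k b p.1 p.2 + Complex.I * (phasePeriod k b : ℂ)))
      (𝓝[regularCurve k b] (ζ, 0)) (𝓝 1)) (m : ℂ) :
    IsValueOfM k b ζ m ↔ ∃ n : ℤ, m = 2 * (Real.pi : ℂ) * (n : ℂ) := by
  have hexp : Complex.exp (Complex.I * m) = 1 ↔ ∃ n : ℤ, m = 2 * (Real.pi : ℂ) * (n : ℂ) := by
    rw [Complex.exp_eq_one_iff]
    refine exists_congr fun n => ?_
    rw [← mul_right_inj' Complex.I_ne_zero (b := m)]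
    constructor <;> intro h <;> rw [h] <;> ring
  have hval : IsValueOfM k b ζ m ↔ IsBranchValueOfM k b ζ 0 m := by
    simp only [IsValueOfM, h0, pow_eq_zero_iff, ne_eq, OfNat.ofNat_ne_zero, not_false_eq_true,
      exists_eq_left]
  rw [hval, ← hexp, IsBranchValueOfM]
  by_cases hreg : IsRegular k b ζ
  · simp only [hreg, not_true_eq_false, true_and, false_and, or_false]
    have h1 := exp_bigI_of_isRegular hk hb hb0 hb1 0 hreg
    rw [mul_zero, zero_mul, Complex.exp_zero] at h1
    rw [← h1, Complex.exp_eq_exp_iff_exists_int]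
    refine exists_congr fun n => ?_
    rw [← mul_right_inj' Complex.I_ne_zero (b := m)]
    have hi := Complex.I_sq
    constructor <;> intro h
    · linear_combination h - 2 * bigI k b ζ 0 * hi
    · linear_combination h + 2 * bigI k b ζ 0 * hi
  · obtain ⟨hne, ht⟩ := hlim hreg
    simp only [hreg, not_false_eq_true, true_and, false_and, false_or]
    exact ⟨fun h => tendsto_nhds_unique h.2 ht, fun h => ⟨hne, h ▸ ht⟩⟩

lemma zetaRoot_re_im (k b : ℝ) :
    (zetaRoot k b 0).re = Real.sqrt (1 - b) / 2 ∧
    (zetaRoot k b 0).im = (Real.sqrt b - Real.sqrt (b - k ^ 2)) / 2 ∧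
    (zetaRoot k b 1).re = -Real.sqrt (1 - b) / 2 ∧
    (zetaRoot k b 1).im = (Real.sqrt b + Real.sqrt (b - k ^ 2)) / 2 ∧
    (zetaRoot k b 2).re = -Real.sqrt (1 - b) / 2 ∧
    (zetaRoot k b 2).im = -(Real.sqrt b + Real.sqrt (b - k ^ 2)) / 2 ∧
    (zetaRoot k b 3).re = Real.sqrt (1 - b) / 2 ∧
    (zetaRoot k b 3).im = -(Real.sqrt b - Real.sqrt (b - k ^ 2)) / 2 := by
  simp [zetaRoot]

/-- All four roots have nonzero real and imaginary parts, so `Im ζ² ≠ 0`, whereas a zero of `B`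
would make `ζ²` real. -/
lemma isRegular_zetaRoot_of_lt_one {k b : ℝ} (hk : k ^ 2 < 1) (hb : k ^ 2 ≤ b) (hb0 : 0 < b)
    (hk0 : k ≠ 0) (hb1 : b < 1) (j : Fin 4) : IsRegular k b (zetaRoot k b j) := fun x hx => by
  have h := congrArg Complex.im
    (sq_eq_of_laxB_eq_zero hk hb hb0 hb1.le (OmegaSq_zetaRoot hb hb0 hb1.le j) hx)
  rw [Complex.ofReal_im, sq, Complex.mul_im] at h
  have hk2 : 0 < k ^ 2 := by positivity
  have hp : 0 < Real.sqrt (1 - b) := Real.sqrt_pos.2 (by linarith)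
  have hr : 0 ≤ Real.sqrt (b - k ^ 2) := Real.sqrt_nonneg _
  have hqr : Real.sqrt (b - k ^ 2) < Real.sqrt b := Real.sqrt_lt_sqrt (by linarith) (by linarith)
  obtain ⟨r0, i0, r1, i1, r2, i2, r3, i3⟩ := zetaRoot_re_im k b
  fin_cases j <;> simp only [Fin.zero_eta, Fin.mk_one, Fin.reduceFinMk, r0, i0, r1, i1, r2, i2,
    r3, i3] at h <;> nlinarith

/-! ### The case `b = 1`, where the profile is `dn`. -/

lemma profileLogDeriv_one {k : ℝ} (hk : k ^ 2 < 1) (x : ℝ) :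
    profileLogDeriv k 1 x = -(negLogDerivDn k x : ℂ) := by
  have ha : ampSq k 1 x = jacobiDn k x ^ 2 := (jacobiDn_sq hk x).symm
  have hd : (jacobiDn k x : ℂ) ≠ 0 := by exact_mod_cast (jacobiDn_pos hk x).ne'
  simp only [profileLogDeriv, phaseConst, negLogDerivDn, ha]
  simp
  field_simp

lemma sqrt_one_sub_sq_eq (k : ℝ) : Real.sqrt (1 - k ^ 2) = compMod k := rfl

lemma isValueOfM_zetaRoot_of_eq_one {k : ℝ} (hk : k ^ 2 < 1) (hk0 : k ≠ 0) (j : Fin 4) (m : ℂ) :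
    IsValueOfM k 1 (zetaRoot k 1 j) m ↔ ∃ n : ℤ, m = 2 * (Real.pi : ℂ) * (n : ℂ) := by
  have hΩ := OmegaSq_zetaRoot hk.le one_pos le_rfl j
  refine isValueOfM_iff_of_limit hk hk.le one_pos le_rfl hΩ (fun hreg => ?_) m
  obtain ⟨r0, i0, r1, i1, r2, i2, r3, i3⟩ := zetaRoot_re_im k 1
  simp only [sub_self, Real.sqrt_zero, Real.sqrt_one, sqrt_one_sub_sq_eq, zero_div, neg_zero]
    at r0 i0 r1 i1 r2 i2 r3 i3
  have hk' := compMod_pos hk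
  have hre : (zetaRoot k 1 j).re = 0 := by
    fin_cases j <;> simpa
  obtain ⟨x₀, hx₀⟩ : ∃ x, laxB k 1 (zetaRoot k 1 j) x = 0 := by
    simpa [IsRegular] using hreg
  have hsq := sq_eq_of_laxB_eq_zero hk hk.le one_pos le_rfl hΩ hx₀
  have him : (zetaRoot k 1 j).im ^ 2 = (1 - compMod k) ^ 2 / 4 := by
    have hj : (zetaRoot k 1 j).im ^ 2 = (1 - compMod k) ^ 2 / 4 ∨
        (zetaRoot k 1 j).im ^ 2 = (1 + compMod k) ^ 2 / 4 := by
      fin_cases j <;> simp only [Fin.zero_eta, Fin.mk_one, Fin.reduceFinMk, i0, i1, i2, i3]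
      · left; ring
      · right; ring
      · right; ring
      · left; ring
    -- For the outer pair `±i(1 + k')/2`, the real value of `ζ²` would give `R²(x₀) = -k' < 0`. Only
    -- the inner pair can be irregular.
    refine hj.resolve_right fun h => ?_
    have h1 := congrArg Complex.re hsq
    rw [Complex.ofReal_re, sq, Complex.mul_re, hre, omega] at h1
    have h2 := ampSq_pos hk x₀
    have h3 := compMod_sq hk
    nlinarith
  have hrg : ∀ ζ : ℂ, IsRegular k 1 ζ ↔ ∀ x, -2 * Complex.I * ζ ≠ negLogDerivDn k x := fun ζ => by
    rw [isRegular_iff_of_lt hk hk]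
    refine forall_congr' fun x => not_congr ?_
    rw [profileLogDeriv_one hk]
    have hi := Complex.I_sq
    constructor <;> intro h
    · linear_combination -2 * Complex.I * h - negLogDerivDn k x * hi
    · linear_combination Complex.I / 2 * h + ζ * hi
  refine ⟨neBot_nhdsWithin_regularCurve hΩ fun ε hε => (hrg _).2 fun x h => ?_,
    tendsto_exp_bigI hk hk.le one_pos le_rfl ?_⟩
  -- The root is purely imaginary, so a shift by real `ε` gives `-2iζ` the imaginary part `-2ε`,
  -- while `g` is real.
  · have h1 := congrArg Complex.im h
    simp [hre] at h1
    linarith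
  have hl : Tendsto (fun p : ℂ × ℂ => -2 * Complex.I * p.1)
      (𝓝[regularCurve k 1] (zetaRoot k 1 j, 0)) (𝓝 (-2 * Complex.I * zetaRoot k 1 j)) :=
    ((continuous_const.mul continuous_fst).tendsto _).mono_left nhdsWithin_le_nhds
  have hz₀ : (-2 * Complex.I * zetaRoot k 1 j) ^ 2 = (1 - compMod k : ℝ) ^ 2 := by
    have hz : zetaRoot k 1 j = ((zetaRoot k 1 j).im : ℂ) * Complex.I := by
      apply Complex.ext <;> simp [hre]
    have him' : ((zetaRoot k 1 j).im : ℂ) ^ 2 = (1 - compMod k : ℝ) ^ 2 / 4 := by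
      exact_mod_cast him
    rw [hz]
    linear_combination 4 * Complex.I ^ 4 * him'
      + (1 - compMod k : ℝ) ^ 2 * (Complex.I ^ 2 - 1) * Complex.I_sq
  have hs : ∀ᶠ p in 𝓝[regularCurve k 1] (zetaRoot k 1 j, (0 : ℂ)), p ∈ regularCurve k 1 :=
    self_mem_nhdsWithin
  refine (tendsto_quartic_mul_sq_integral hk hk0 hz₀ hl ?_).congr' ?_
  · filter_upwards [hs] with p hp
    exact (hrg _).1 hp.2
  · filter_upwards [hs] with p hp
    have hint : (∫ x in (0 : ℝ)..(period k), profile k 1 x / laxB k 1 p.1 x) =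
        -2 * Complex.I *
          ∫ x in (0 : ℝ)..(period k), 1 / (-2 * Complex.I * p.1 - negLogDerivDn k x) := by
      rw [← intervalIntegral.integral_const_mul]
      refine intervalIntegral.integral_congr fun x _ => ?_
      have h1 := sub_ne_zero.2 ((hrg _).1 hp.2 x)
      have h2 := (isRegular_iff_of_lt hk hk p.1).1 hp.2 x
      rw [profile_div_laxB_of_lt hk hk, profileLogDeriv_one hk] at *
      rw [mul_one_div, div_eq_div_iff h2 h1]
      linear_combination -negLogDerivDn k x * Complex.I_sq
    have hOm : OmegaSq k 1 p.1 = -(((-2 * Complex.I * p.1) ^ 2 - (1 - compMod k : ℝ) ^ 2) *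
        ((-2 * Complex.I * p.1) ^ 2 - (1 + compMod k : ℝ) ^ 2)) / 16 := by
      have h3 : (compMod k : ℂ) ^ 2 = 1 - k ^ 2 := by exact_mod_cast compMod_sq hk
      have hi := Complex.I_sq
      have hc : phaseConst k 1 = 0 := by simp [phaseConst]
      have h5 : (-2 * Complex.I * p.1) ^ 2 = -4 * p.1 ^ 2 := by
        linear_combination 4 * p.1 ^ 2 * hi
      rw [h5]
      simp only [OmegaSq, hc, omega]
      push_cast
      linear_combination (p.1 ^ 2 / 2 + (compMod k ^ 2 - 1 - k ^ 2) / 16) * h3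
    rw [hint, hOm]
    linear_combination (((-2 * Complex.I * p.1) ^ 2 - (1 - compMod k : ℝ) ^ 2) *
        ((-2 * Complex.I * p.1) ^ 2 - (1 + compMod k : ℝ) ^ 2)) *
        (∫ x in (0 : ℝ)..(period k), 1 / (-2 * Complex.I * p.1 - negLogDerivDn k x)) ^ 2 *
        Complex.I_sq

/-! ### The case `k = 0`, where the profile is a plane wave. -/

lemma profileLogDeriv_zero_modulus {b : ℝ} (hb0 : 0 < b) (x : ℝ) :
    profileLogDeriv 0 b x = Complex.I * (Real.sqrt (1 - b) : ℂ) := by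
  have hc : phaseConst 0 b = b * Real.sqrt (1 - b) := by
    rw [phaseConst, show b * (1 - b) * (b - 0 ^ 2) = b ^ 2 * (1 - b) by ring,
      Real.sqrt_mul (sq_nonneg b), Real.sqrt_sq hb0.le]
  have hb : (b : ℂ) ≠ 0 := by exact_mod_cast hb0.ne'
  simp only [profileLogDeriv, hc, ampSq]
  simp
  field_simp

/-- Here `B/φ = ζ - √(1 - b)/2` is constant in `x`, and `√(1 - b)/2` is the double root `ζ₁ = ζ₄` of
`Ω²`. The double zero of `Ω²` cancels the double pole of `(∫ φ/B)²`. -/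
lemma isValueOfM_zetaRoot_of_modulus_eq_zero {b : ℝ} (hb0 : 0 < b) (hb1 : b ≤ 1) (j : Fin 4)
    (m : ℂ) :
    IsValueOfM 0 b (zetaRoot 0 b j) m ↔ ∃ n : ℤ, m = 2 * (Real.pi : ℂ) * (n : ℂ) := by
  have hk : (0 : ℝ) ^ 2 < 1 := by norm_num
  have hb : (0 : ℝ) ^ 2 < b := by simpa using hb0
  have hΩ := OmegaSq_zetaRoot hb.le hb0 hb1 j
  refine isValueOfM_iff_of_limit hk hb.le hb0 hb1 hΩ (fun hreg => ?_) m
  have hden : ∀ ζ : ℂ, ∀ x, ζ + Complex.I / 2 * profileLogDeriv 0 b x =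
      ζ - (Real.sqrt (1 - b) : ℂ) / 2 := fun ζ x => by
    rw [profileLogDeriv_zero_modulus hb0]
    linear_combination (Real.sqrt (1 - b) : ℂ) / 2 * Complex.I_sq
  have hrg : ∀ ζ : ℂ, IsRegular 0 b ζ ↔ ζ - (Real.sqrt (1 - b) : ℂ) / 2 ≠ 0 := fun ζ => by
    rw [isRegular_iff_of_lt hk hb]
    simp only [hden, forall_const]
  rw [hrg, not_not, sub_eq_zero] at hreg
  refine ⟨neBot_nhdsWithin_regularCurve hΩ fun ε hε => ?_,
    tendsto_exp_bigI hk hb.le hb0 hb1 ?_⟩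
  · rw [hrg, hreg, add_sub_cancel_left]
    exact_mod_cast hε.ne'
  rw [hreg]
  have hs : ∀ᶠ p in 𝓝[regularCurve 0 b] ((Real.sqrt (1 - b) : ℂ) / 2, (0 : ℂ)),
      p ∈ regularCurve 0 b := self_mem_nhdsWithin
  have hcont : Continuous fun p : ℂ × ℂ =>
      -4 * (Real.pi : ℂ) ^ 2 * ((p.1 - zetaRoot 0 b 1) * (p.1 - zetaRoot 0 b 2)) := by fun_prop
  have ht := (hcont.tendsto ((Real.sqrt (1 - b) : ℂ) / 2, 0)).mono_left
    (nhdsWithin_le_nhds (s := regularCurve 0 b))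
  have hp : (Real.sqrt (1 - b) : ℂ) ^ 2 = 1 - b := by
    exact_mod_cast Real.sq_sqrt (by linarith : 0 ≤ 1 - b)
  have hq : (Real.sqrt b : ℂ) ^ 2 = b := by exact_mod_cast Real.sq_sqrt hb0.le
  have hsub : b - (0 : ℝ) ^ 2 = b := by ring
  -- At the double root the other two factors multiply to `(1 - b) + b = 1`.
  have hval : -4 * (Real.pi : ℂ) ^ 2 * (((Real.sqrt (1 - b) : ℂ) / 2 - zetaRoot 0 b 1) *
      ((Real.sqrt (1 - b) : ℂ) / 2 - zetaRoot 0 b 2)) = -(4 * Real.pi ^ 2) := by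
    simp only [zetaRoot, Matrix.cons_val, hsub]
    linear_combination -4 * (Real.pi : ℂ) ^ 2 * (hp + hq - Real.sqrt b ^ 2 * Complex.I_sq)
  simp only [hval] at ht
  refine ht.congr' ?_
  filter_upwards [hs] with p hps
  have h0 := (hrg _).1 hps.2
  have hint : (∫ x in (0 : ℝ)..(period 0), profile 0 b x / laxB 0 b p.1 x) =
      Real.pi / (p.1 - (Real.sqrt (1 - b) : ℂ) / 2) := by
    simp only [profile_div_laxB_of_lt hk hb, hden, intervalIntegral.integral_const,
      period_zero_modulus, Complex.real_smul, sub_zero, mul_one_div]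
  have e0 : zetaRoot 0 b 0 = (Real.sqrt (1 - b) : ℂ) / 2 := by
    simp only [zetaRoot, Matrix.cons_val, hsub]
    ring
  have e3 : zetaRoot 0 b 3 = (Real.sqrt (1 - b) : ℂ) / 2 := by
    simp only [zetaRoot, Matrix.cons_val, hsub]
    ring
  rw [hint, OmegaSq_eq_prod hb.le hb0 hb1, e0, e3]
  generalize p.1 - (Real.sqrt (1 - b) : ℂ) / 2 = δ at h0 ⊢
  field_simp

end

end NLSElliptic

theorem mainTheorem9 (k b : ℝ) (hk0 : 0 ≤ k) (hk1 : k < 1) (hkb : k ^ 2 ≤ b) (hb1 : b ≤ 1)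
    (hb0 : 0 < b) :
    (∀ ζ : ℂ, NLSElliptic.OmegaSq k b ζ
      = -((ζ - NLSElliptic.zetaRoot k b 0) * (ζ - NLSElliptic.zetaRoot k b 1)
        * (ζ - NLSElliptic.zetaRoot k b 2) * (ζ - NLSElliptic.zetaRoot k b 3))) ∧
    ∀ (j : Fin 4) (m : ℂ),
      NLSElliptic.IsValueOfM k b (NLSElliptic.zetaRoot k b j) m ↔
        ∃ n : ℤ, m = 2 * (Real.pi : ℂ) * (n : ℂ) := by
  refine ⟨NLSElliptic.OmegaSq_eq_prod hkb hb0 hb1, fun j m => ?_⟩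
  have hk : k ^ 2 < 1 := by nlinarith
  rcases hk0.eq_or_lt with rfl | hkpos
  · exact NLSElliptic.isValueOfM_zetaRoot_of_modulus_eq_zero hb0 hb1 j m
  rcases hb1.eq_or_lt with rfl | hb1'
  · exact NLSElliptic.isValueOfM_zetaRoot_of_eq_one hk hkpos.ne' j m
  · exact NLSElliptic.isValueOfM_iff_of_limit hk hkb hb0 hb1
      (NLSElliptic.OmegaSq_zetaRoot hkb hb0 hb1 j)
      (fun h => absurd (NLSElliptic.isRegular_zetaRoot_of_lt_one hk hkb hb0 hkpos.ne' hb1' j) h) m
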